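/- **Setting.** Let $T$ be the binary rooted tree. For $\omega=\omega_0\omega_1\omega_2\dots\in\{0,1,2\}^{\mathbb N}$, with shift $\sigma\omega=\omega_1\omega_2\dots$, let $G_\omega=\langle a,b_\omega,c_\omega,d_\omega\rangle\le \mathrm{Aut}(T)$, where $a$ exchanges the two subtrees of the root and, for $v\in\{b,c,d\}$, $v_\omega=(u^v(\omega_0),v_{\sigma\omega})$ acts on the subtrees $0$ and $1$ of the root by $u^v(\omega_0)$ and $v_{\sigma\omega}$ respectively, with $$(u^b(0),u^b(1),u^b(2))=(a,a,\mathrm{id}),\quad (u^c(0),u^c(1),u^c(2))=(a,\mathrm{id},a),\quad (u^d(0),u^d(1),u^d(2))=(\mathrm{id},a,a).$$ Let $\rho=1^\infty\in\partial T$, let $X$ be the orbit of $\rho$ under $G_\omega$, and fix a nontrivial finite group $F$. Let $\Gamma_\omega=F\wr_X G_\omega=\big(\bigoplus_X F\big)\rtimes G_\omega$ be the permutational wreath product, with finite generating set $S_\omega=\{a\}\cup\{\varphi_f v : f\in F,\ v\in\{\mathrm{id},b_\omega,c_\omega,d_\omega\}\}$, where $\varphi_f$ has value $f$ at $\rho$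 and $\mathrm{id}_F$ elsewhere, and growth function $b_\omega(r)=\#(S_\omega^r)$, $r\in\mathbb N$. Put $$\underline\alpha(\Gamma_\omega)=\liminf_{r\to\infty}\frac{\log\log b_\omega(r)}{\log r},\qquad \overline\alpha(\Gamma_\omega)=\limsup_{r\to\infty}\frac{\log\log b_\omega(r)}{\log r}.$$ Write $f\precsim g$ if there is a constant $C$ with $f(r)\le g(Cr)$ for all $r$; two functions are comparable if $f\precsim g$ or $g\precsim f$. Let $\eta$ be the real root of $X^3+X^2+X-2$ and $\alpha_0=\frac{\log 2}{\log 2-\log\eta}$ (so $\eta\approx0.8105$ and $\alpha_0\approx0.7674$). **Theorem.** (1) For any $\alpha_0\le\alpha<\beta\le1$ there is an uncountable set $\Omega\subset\{0,1,2\}^{\mathbb N}$ such that the functions $b_\omega$, $\omega\in\Omega$, are pairwise non comparable and $\underline\alpha(\Gamma_\omega)=\alpha$, $\overline\alpha(\Gamma_\omega)=\beta$ for every $\omega\in\Omega$. (2) For any $\beta<\beta'\le1$ there is a constant $C$, depending only on $\beta,\beta'$ (and on the fixed group $F$), such that for any $\alpha$ with $\alpha_0\le\alpha<\beta$ a set $\Omega$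 as in (1) can be chosen so that moreover $b_\omega(r)\le Ce^{r^{\beta'}}$ for all $\omega\in\Omega$ and all $r\in\mathbb N$. (3) For any $\alpha_0\le\alpha<\beta\le1$ there are a map $f\mapsto\omega(f)$ from the set of functions $f:\mathbb N\to\{\alpha,\beta\}$ to $\{0,1,2\}^{\mathbb N}$, integers $r_i\ge2$ with $r_i\to\infty$, and reals $0<\varepsilon_i<\frac{\beta-\alpha}2$ with $\varepsilon_i\to0$, such that for every $f$: - $\underline\alpha(\Gamma_{\omega(f)})=\alpha$ and $\overline\alpha(\Gamma_{\omega(f)})=\beta$; - $\frac{\log\log b_{\omega(f)}(r_i)}{\log r_i}\ge\beta-\varepsilon_i$ for every $i$ with $f(i)=\beta$; - $\frac{\log\log b_{\omega(f)}(r_i)}{\log r_i}\le\alpha+\varepsilon_i$ for every $i$ with $f(i)=\alpha$. -/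

import Mathlib

open Filter Topology
open scoped Pointwise

noncomputable section

namespace GrowthGroups

/-! Growth functions of groups. -/

/-- The growth function `b_S(r) = #(S ^ r)` of a group with respect to a generating set `S`
(used for finite symmetric sets `S` containing the identity, so that `S ^ r` is the ball of
radius `r` of the word norm). -/
def growth {G : Type*} [Group G] (S : Set G) (r : ℕ) : ℕ := (S ^ r).ncard

/-- The order `f ≾ g` on growth functions: `f r ≤ g (C r)` for some constant `C` and all `r`. -/
def GrowthLE (f g : ℕ → ℕ) : Prop := ∃ C : ℕ, ∀ r : ℕ, f r ≤ g (C * r)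

/-- Two growth functions are non comparable for the order `≾`. -/
def GrowthIncomparable (f g : ℕ → ℕ) : Prop := ¬ GrowthLE f g ∧ ¬ GrowthLE g f

/-- `log log b(r) / log r`. -/
def logLogRatio (b : ℕ → ℕ) (r : ℕ) : ℝ := Real.log (Real.log (b r)) / Real.log r

/-- The upper logarithmic growth exponent (the upper limit is taken in the extended reals, so
that it always exists). -/
def upperExponent (b : ℕ → ℕ) : EReal := limsup (fun r => (logLogRatio b r : EReal)) atTop

/-- The lower logarithmic growth exponent. -/
def lowerExponent (b : ℕ → ℕ) : EReal := liminf (fun r => (logLogRatio b r : EReal)) atTop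

/-! The groups `G_ω`. Automorphisms of the binary rooted tree `T` are represented by their
(faithful) action on the boundary of `T`, the set of infinite binary sequences. -/

/-- The boundary `∂T` of the binary rooted tree; `false` and `true` stand for `0` and `1`. -/
abbrev Ray : Type := ℕ → Bool

/-- The ray without its first letter. -/
def Ray.tail (x : Ray) : Ray := fun n => x (n + 1)

/-- The generator `a = (1,1)ε`: it exchanges the two subtrees of the root. -/
def genA : Equiv.Perm Ray where
  toFun x := Function.update x 0 (!(x 0))
  invFun x := Function.update x 0 (!(x 0))
  left_inv x := by simp
  right_inv x := by simp

/-- Names for the three other generators. -/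
inductive Letter : Type
  | b | c | d

/-- `uIsA v i` says whether `u^v(i)` is `a` (`true`) or the identity (`false`). -/
def uIsA : Letter → Fin 3 → Bool
  | .b => ![true, true, false]
  | .c => ![true, false, true]
  | .d => ![false, true, true]

/-- The automorphism `u^v(i)`, which is `a` or the identity. -/
def u (v : Letter) (i : Fin 3) : Equiv.Perm Ray := if uIsA v i then genA else 1

/-- The shift `σω = ω₁ω₂…` of `ω = ω₀ω₁ω₂…`. -/
def shift (ω : ℕ → Fin 3) : ℕ → Fin 3 := fun n => ω (n + 1)

/-- The recursion `v_ω = (u^v(ω₀), v_{σω})`: the first letter `x₀` of a ray is fixed, and the rest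
of the ray is acted on by `u^v(ω₀)` if `x₀ = 0` and by `v_{σω}` if `x₀ = 1`. The recursion is on
the index of the letter of the image that is computed. -/
def genFun (v : Letter) : (ℕ → Fin 3) → Ray → ℕ → Bool
  | _, x, 0 => x 0
  | ω, x, n + 1 => if x 0 then genFun v (shift ω) x.tail n else u v (ω 0) x.tail n

theorem genFun_tail (v : Letter) (ω : ℕ → Fin 3) (x : Ray) :
    Ray.tail (genFun v ω x) =
      if x 0 then genFun v (shift ω) x.tail else u v (ω 0) x.tail := by
  funext n
  by_cases h : x 0 <;> simp [Ray.tail, genFun, h]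

theorem u_u (v : Letter) (i : Fin 3) (x : Ray) : u v i (u v i x) = x := by
  unfold u
  split_ifs
  · exact genA.left_inv x
  · rfl

theorem genFun_genFun (v : Letter) (ω : ℕ → Fin 3) (x : Ray) :
    genFun v ω (genFun v ω x) = x := by
  funext n
  induction n generalizing ω x with
  | zero => rfl
  | succ n ih =>
    have h0 : genFun v ω x 0 = x 0 := rfl
    rw [genFun, genFun_tail, h0]
    by_cases h : x 0
    · simp only [h, if_true]
      exact ih _ _
    · simp only [h, if_false, u_u, Bool.false_eq_true]
      rfl

/-- The generators `b_ω`, `c_ω`, `d_ω` of `G_ω`. -/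
def gen (v : Letter) (ω : ℕ → Fin 3) : Equiv.Perm Ray where
  toFun := genFun v ω
  invFun := genFun v ω
  left_inv := genFun_genFun v ω
  right_inv := genFun_genFun v ω

/-- The group `G_ω = ⟨a, b_ω, c_ω, d_ω⟩`. -/
def GOmega (ω : ℕ → Fin 3) : Subgroup (Equiv.Perm Ray) :=
  Subgroup.closure {genA, gen .b ω, gen .c ω, gen .d ω}

/-- `a` as an element of `G_ω`. -/
def elA (ω : ℕ → Fin 3) : GOmega ω := ⟨genA, Subgroup.subset_closure (by simp)⟩

/-- `b_ω`, `c_ω`, `d_ω` as elements of `G_ω`. -/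
def el (v : Letter) (ω : ℕ → Fin 3) : GOmega ω :=
  ⟨gen v ω, Subgroup.subset_closure (by cases v <;> simp)⟩

/-! Permutational wreath products. -/

/-- The group of finitely supported functions `X → F`. -/
def FinSupp (F X : Type*) [Group F] : Subgroup (X → F) where
  carrier := {φ | (Function.mulSupport φ).Finite}
  mul_mem' := fun hf hg => (hf.union hg).subset (Function.mulSupport_mul _ _)
  one_mem' := by simp
  inv_mem' := by
    intro φ hφ
    simpa [Function.mulSupport_inv] using hφ

/-- Translation of finitely supported functions by an element of a group acting on `X`. -/
def translate {F X G : Type*} [Group F] [Group G] [MulAction G X] (g : G) (φ : FinSupp F X) :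
    FinSupp F X :=
  ⟨fun x => φ.1 (g⁻¹ • x), by
    have h : (Function.mulSupport φ.1).Finite := φ.2
    exact h.preimage (f := fun x => g⁻¹ • x) (MulAction.injective g⁻¹).injOn⟩

/-- The action of `G` on finitely supported functions `X → F`. In terms of the right action
`x g = g⁻¹ • x` it reads `(g.φ)(x) = φ(x g)`. (The generators of `G_ω` are involutions, so
that they are the same for the left and for the right action.) -/
def lampAction (F X G : Type*) [Group F] [Group G] [MulAction G X] :
    G →* MulAut (FinSupp F X) where
  toFun g :=
    { toFun := translate g
      invFun := translate g⁻¹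
      left_inv := fun φ => by ext x; simp [translate]
      right_inv := fun φ => by ext x; simp [translate]
      map_mul' := fun φ ψ => by ext x; simp [translate] }
  map_one' := by ext φ x; simp [translate]
  map_mul' g h := by ext φ x; simp [translate, mul_smul]

/-- The permutational wreath product `F ≀_X G`, that is the group of the elements `φ g` with the
computation rule `(φ₁ g₁)(φ₂ g₂) = (φ₁ (g₁.φ₂)) (g₁ g₂)`. -/
abbrev PermWreath (F X G : Type*) [Group F] [Group G] [MulAction G X] : Type _ :=
  FinSupp F X ⋊[lampAction F X G] G

/-! The groups `Γ_ω`. -/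

/-- The rightmost ray `ρ = 1^∞`. -/
def rho : Ray := fun _ => true

/-- The orbit `X` of `ρ` under `G_ω`. -/
abbrev Orb (ω : ℕ → Fin 3) : Type := MulAction.orbit (GOmega ω) rho

/-- `ρ` as a point of its orbit. -/
def rhoOrb (ω : ℕ → Fin 3) : Orb ω := ⟨rho, MulAction.mem_orbit_self rho⟩

/-- The group `Γ_ω = F ≀_X G_ω`. -/
abbrev Gam (F : Type*) [Group F] (ω : ℕ → Fin 3) : Type _ := PermWreath F (Orb ω) (GOmega ω)

open Classical in
/-- The function with value `f` at the point `x` and the identity elsewhere. -/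
def single {F X : Type*} [Group F] (x : X) (f : F) : FinSupp F X :=
  ⟨Pi.mulSingle x f, (Set.finite_singleton x).subset Pi.mulSupport_mulSingle_subset⟩

/-- The generating set `S_ω = {a} ∪ {φ_f v | v ∈ {id, b_ω, c_ω, d_ω}, f ∈ F}` of `Γ_ω`, where
`φ_f` has value `f` at `ρ` and the identity elsewhere. -/
def genSet (F : Type*) [Group F] (ω : ℕ → Fin 3) : Set (Gam F ω) :=
  {SemidirectProduct.inr (elA ω)} ∪
    {γ | ∃ f : F, ∃ v ∈ ({1, el .b ω, el .c ω, el .d ω} : Set (GOmega ω)),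
      γ = SemidirectProduct.inl (single (rhoOrb ω) f) * SemidirectProduct.inr v}

/-- The growth function `b_ω` of `Γ_ω` with respect to `S_ω`. -/
def bOmega (F : Type*) [Group F] (ω : ℕ → Fin 3) : ℕ → ℕ := growth (genSet F ω)

/-- `Ω` is an uncountable set of sequences `ω` for which the groups `Γ_ω` have pairwise non
comparable growth functions, lower exponent `α` and upper exponent `β`. -/
def IsUncountableAntichain (F : Type*) [Group F] (α β : ℝ) (Ω : Set (ℕ → Fin 3)) : Prop :=
  ¬ Ω.Countable ∧
  (∀ ω ∈ Ω, ∀ ω' ∈ Ω, ω ≠ ω' → GrowthIncomparable (bOmega F ω) (bOmega F ω')) ∧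
  ∀ ω ∈ Ω, lowerExponent (bOmega F ω) = (α : EReal) ∧ upperExponent (bOmega F ω) = (β : EReal)

/-! `S_ω` is a finite symmetric generating set of `Γ_ω` that contains the identity. -/

theorem single_one {F X : Type*} [Group F] (x : X) : single x (1 : F) = 1 := by
  ext y; simp [single]

theorem translate_single {F X G : Type*} [Group F] [Group G] [MulAction G X] (g : G) (x : X)
    (f : F) : lampAction F X G g (single x f) = single (g • x) f := by
  ext y
  have h : g⁻¹ • y = x ↔ y = g • x := inv_smul_eq_iff
  simp only [lampAction, translate, single, Pi.mulSingle_apply, MonoidHom.coe_mk, OneHom.coe_mk,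
    MulEquiv.coe_mk, Equiv.coe_fn_mk]
  by_cases hy : y = g • x
  · rw [if_pos hy, if_pos (h.2 hy)]
  · rw [if_neg hy, if_neg (fun h' => hy (h.1 h'))]

theorem one_mem_genSet (F : Type*) [Group F] (ω : ℕ → Fin 3) : 1 ∈ genSet F ω :=
  Or.inr ⟨1, 1, by simp, by simp [single_one]⟩

theorem genSet_finite (F : Type*) [Group F] [Finite F] (ω : ℕ → Fin 3) :
    (genSet F ω).Finite := by
  refine (Set.finite_singleton _).union ?_
  have h : ((Set.univ : Set F) ×ˢ
      ({1, el .b ω, el .c ω, el .d ω} : Set (GOmega ω))).Finite :=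
    Set.finite_univ.prod (by simp)
  refine (h.image (fun p : F × GOmega ω =>
    (SemidirectProduct.inl (single (rhoOrb ω) p.1) * SemidirectProduct.inr p.2 :
      Gam F ω))).subset ?_
  rintro γ ⟨f, v, hv, rfl⟩
  exact ⟨(f, v), ⟨trivial, hv⟩, rfl⟩

theorem genFun_rho (v : Letter) (ω : ℕ → Fin 3) : genFun v ω rho = rho := by
  funext n
  induction n generalizing ω with
  | zero => rfl
  | succ n ih => exact ih (shift ω)

theorem elA_inv (ω : ℕ → Fin 3) : (elA ω)⁻¹ = elA ω := rfl

theorem el_inv (v : Letter) (ω : ℕ → Fin 3) : (el v ω)⁻¹ = el v ω := rfl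

theorem el_smul_rho (v : Letter) (ω : ℕ → Fin 3) : el v ω • rhoOrb ω = rhoOrb ω :=
  Subtype.ext (genFun_rho v ω)

theorem inv_genSet (F : Type*) [Group F] (ω : ℕ → Fin 3) : (genSet F ω)⁻¹ = genSet F ω := by
  have key : ∀ γ ∈ genSet F ω, γ⁻¹ ∈ genSet F ω := by
    rintro γ (rfl | ⟨f, v, hv, rfl⟩)
    · left
      rw [← map_inv, elA_inv]; rfl
    · right
      have h1 : v⁻¹ = v ∧ v • rhoOrb ω = rhoOrb ω := by
        simp only [Set.mem_insert_iff, Set.mem_singleton_iff] at hv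
        rcases hv with rfl | rfl | rfl | rfl
        · simp
        all_goals exact ⟨el_inv _ _, el_smul_rho _ _⟩
      have hs : (single (rhoOrb ω) f)⁻¹ = single (rhoOrb ω) f⁻¹ := by
        ext y; simp [single, Pi.mulSingle_inv]
      refine ⟨f⁻¹, v, hv, ?_⟩
      rw [mul_inv_rev, ← map_inv, ← map_inv, h1.1, hs]
      have h2 := SemidirectProduct.inl_aut (φ := lampAction F (Orb ω) (GOmega ω)) v
        (single (rhoOrb ω) f⁻¹)
      rw [translate_single, h1.2] at h2
      nth_rewrite 2 [h2]
      rw [map_inv, inv_mul_cancel_right]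
  ext γ
  exact ⟨fun h => by simpa using key _ h, fun h => key _ h⟩

theorem closure_genSet (F : Type*) [Group F] (ω : ℕ → Fin 3) :
    Subgroup.closure (genSet F ω) = ⊤ := by
  set H := Subgroup.closure (genSet F ω) with hH
  have hv : ∀ v : Letter, (SemidirectProduct.inr (el v ω) : Gam F ω) ∈ H := by
    intro v
    refine Subgroup.subset_closure (Or.inr ⟨1, el v ω, ?_, by simp [single_one]⟩)
    cases v <;> simp
  have hr : ∀ g : GOmega ω, (SemidirectProduct.inr g : Gam F ω) ∈ H := by
    rintro ⟨g, hg⟩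
    induction hg using Subgroup.closure_induction with
    | mem x hx =>
      simp only [Set.mem_insert_iff, Set.mem_singleton_iff] at hx
      rcases hx with rfl | rfl | rfl | rfl
      · exact Subgroup.subset_closure (Or.inl rfl)
      · exact hv .b
      · exact hv .c
      · exact hv .d
    | one => exact H.one_mem
    | mul x y hx hy ihx ihy =>
      have := H.mul_mem ihx ihy
      rwa [← map_mul] at this
    | inv x hx ih =>
      have := H.inv_mem ih
      rwa [← map_inv] at this
  have hs : ∀ (x : Orb ω) (f : F), (SemidirectProduct.inl (single x f) : Gam F ω) ∈ H := by
    rintro ⟨_, g, rfl⟩ f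
    have h2 := SemidirectProduct.inl_aut (φ := lampAction F (Orb ω) (GOmega ω)) g
      (single (rhoOrb ω) f)
    rw [translate_single] at h2
    have h3 : g • rhoOrb ω = ⟨(fun m : GOmega ω => m • rho) g, g, rfl⟩ := rfl
    rw [← h3, h2]
    refine H.mul_mem (H.mul_mem (hr g) (Subgroup.subset_closure (Or.inr ⟨f, 1, ?_, ?_⟩))) (hr g⁻¹)
    · simp
    · simp
  have hl : ∀ (s : Finset (Orb ω)) (φ : FinSupp F (Orb ω)),
      Function.mulSupport φ.1 ⊆ s → (SemidirectProduct.inl φ : Gam F ω) ∈ H := by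
    classical
    intro s
    induction s using Finset.induction_on with
    | empty =>
      intro φ hφ
      have : φ = 1 := Subtype.ext (Function.mulSupport_eq_empty_iff.mp (by simpa using hφ))
      rw [this, map_one]; exact H.one_mem
    | insert x s hx ih =>
      intro φ hφ
      have h1 := ih ((single x (φ.1 x))⁻¹ * φ) (by
        intro y hy
        by_cases hyx : y = x
        · subst hyx
          simp [single] at hy
        · have : y ∈ Function.mulSupport φ.1 := by
            simpa [single, hyx, Pi.mulSingle_apply] using hy
          simpa [hyx] using hφ this)
      have := H.mul_mem (hs x (φ.1 x)) h1
      rwa [← map_mul, mul_inv_cancel_left] at this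
  rw [eq_top_iff]
  rintro γ -
  rw [← SemidirectProduct.inl_left_mul_inr_right γ]
  have hfin : (Function.mulSupport γ.left.1).Finite := γ.left.2
  exact H.mul_mem (hl hfin.toFinset γ.left (by simp)) (hr γ.right)

end GrowthGroups

end

noncomputable section

namespace GrowthGroups

/-! Permutations of `∂T × F`, an ambient group for the groups `Γ_ω`. -/

/-- The ray with first letter `i` and tail `x`. -/
def Ray.cons (i : Bool) (x : Ray) : Ray
  | 0 => i
  | n + 1 => x n

@[simp] theorem Ray.cons_zero (i : Bool) (x : Ray) : Ray.cons i x 0 = i := rfl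

@[simp] theorem Ray.tail_cons (i : Bool) (x : Ray) : (Ray.cons i x).tail = x := rfl

theorem Ray.cons_eta (x : Ray) : Ray.cons (x 0) x.tail = x := by
  funext n; cases n <;> rfl

theorem Ray.ext_head_tail {x y : Ray} (h0 : x 0 = y 0) (h : x.tail = y.tail) : x = y := by
  rw [← Ray.cons_eta x, ← Ray.cons_eta y, h0, h]

theorem Ray.cons_eq_rho {i : Bool} {x : Ray} : Ray.cons i x = rho ↔ i = true ∧ x = rho := by
  constructor
  · intro h
    exact ⟨congrFun h 0, funext fun n => congrFun h (n + 1)⟩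
  · rintro ⟨rfl, rfl⟩
    funext n; cases n <;> rfl

/-- The group of permutations of `∂T × F`. -/
abbrev LampPerm (F : Type*) : Type _ := Equiv.Perm (Ray × F)

/-- The map acting by `P` on the left subtree and by `Q` on the right subtree. -/
def nodeFun {F : Type*} (P Q : Ray × F → Ray × F) (z : Ray × F) : Ray × F :=
  let y := (if z.1 0 then Q else P) (z.1.tail, z.2)
  (Ray.cons (z.1 0) y.1, y.2)

theorem nodeFun_nodeFun {F : Type*} (P Q P' Q' : Ray × F → Ray × F) (z : Ray × F) :
    nodeFun P Q (nodeFun P' Q' z) = nodeFun (P ∘ P') (Q ∘ Q') z := by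
  by_cases h : z.1 0 <;> simp [nodeFun, h]

theorem nodeFun_id {F : Type*} (z : Ray × F) : nodeFun id id z = z := by
  simp [nodeFun, Ray.cons_eta]

/-- The permutation acting by `P` on the left subtree and by `Q` on the right subtree. -/
def node {F : Type*} (P Q : LampPerm F) : LampPerm F where
  toFun := nodeFun P Q
  invFun := nodeFun P.symm Q.symm
  left_inv z := by rw [nodeFun_nodeFun]; simp [nodeFun_id]
  right_inv z := by rw [nodeFun_nodeFun]; simp [nodeFun_id]

theorem node_mul {F : Type*} (P Q P' Q' : LampPerm F) :
    node P Q * node P' Q' = node (P * P') (Q * Q') :=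
  Equiv.ext fun z => nodeFun_nodeFun P Q P' Q' z

theorem node_one {F : Type*} : node (1 : LampPerm F) 1 = 1 :=
  Equiv.ext nodeFun_id

theorem node_inj {F : Type*} {P Q P' Q' : LampPerm F} (h : node P Q = node P' Q') :
    P = P' ∧ Q = Q' := by
  have key : ∀ (i : Bool) (z : Ray × F), (if i then Q else P) z = (if i then Q' else P') z := by
    intro i z
    have h1 := Equiv.congr_fun h (Ray.cons i z.1, z.2)
    cases i <;>
    · simp only [node, nodeFun, Equiv.coe_fn_mk, Ray.cons_zero, Ray.tail_cons, Prod.mk.injEq,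
        Bool.false_eq_true, if_false, if_true] at h1 ⊢
      refine Prod.ext ?_ h1.2
      simpa using congrArg Ray.tail h1.1
  exact ⟨Equiv.ext (key false), Equiv.ext (key true)⟩

/-- The action of `a` on `∂T × F`. -/
def swapA (F : Type*) : LampPerm F := Equiv.prodCongr genA (Equiv.refl F)

theorem swapA_apply {F : Type*} (z : Ray × F) :
    swapA F z = (Ray.cons (!(z.1 0)) z.1.tail, z.2) := by
  refine Prod.ext ?_ rfl
  funext n
  cases n <;> simp [swapA, genA, Ray.cons, Ray.tail]

theorem swapA_mul_self (F : Type*) : swapA F * swapA F = 1 :=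
  Equiv.ext fun z => Prod.ext (genA.left_inv z.1) rfl

theorem swapA_mul_swapA_mul {F : Type*} (g : LampPerm F) : swapA F * (swapA F * g) = g := by
  rw [← mul_assoc, swapA_mul_self, one_mul]

theorem swapA_mul_node {F : Type*} (P Q : LampPerm F) :
    swapA F * node P Q = node Q P * swapA F := by
  refine Equiv.ext fun z => ?_
  rw [Equiv.Perm.mul_apply, Equiv.Perm.mul_apply, swapA_apply, swapA_apply]
  by_cases h : z.1 0 <;> simp [node, nodeFun, h]

theorem swapA_mul_node_mul {F : Type*} (P Q g : LampPerm F) :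
    swapA F * (node P Q * g) = node Q P * (swapA F * g) := by
  rw [← mul_assoc, swapA_mul_node, mul_assoc]

theorem node_mul_node_mul {F : Type*} (P Q P' Q' g : LampPerm F) :
    node P Q * (node P' Q' * g) = node (P * P') (Q * Q') * g := by
  rw [← mul_assoc, node_mul]

/-- `b_ω`, `c_ω`, `d_ω` or the identity. -/
def optGen (ω : ℕ → Fin 3) : Option Letter → Ray → Ray
  | none => id
  | some v => genFun v ω

/-- Does the left section of `v_ω` equal `a`? -/
def optIsA (i : Fin 3) : Option Letter → Bool
  | none => false
  | some v => uIsA v i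

/-- The multiplication of the four-group `{id, b, c, d}`. -/
def kleinMul : Option Letter → Option Letter → Option Letter
  | none, v => v
  | v, none => v
  | some .b, some .b => none
  | some .c, some .c => none
  | some .d, some .d => none
  | some .b, some .c => some .d
  | some .c, some .b => some .d
  | some .b, some .d => some .c
  | some .d, some .b => some .c
  | some .c, some .d => some .b
  | some .d, some .c => some .b

theorem optGen_zero (ω : ℕ → Fin 3) (v : Option Letter) (x : Ray) : optGen ω v x 0 = x 0 := by
  cases v <;> rfl

theorem optGen_tail (ω : ℕ → Fin 3) (v : Option Letter) (x : Ray) :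
    (optGen ω v x).tail = if x 0 then optGen (shift ω) v x.tail
      else if optIsA (ω 0) v then genA x.tail else x.tail := by
  cases v with
  | none => simp [optGen, optIsA]
  | some v =>
    simp only [optGen, optIsA, genFun_tail, u]
    by_cases h : uIsA v (ω 0) = true <;> simp only [h] <;> rfl

theorem optGen_optGen (ω : ℕ → Fin 3) (v v' : Option Letter) (x : Ray) :
    optGen ω v (optGen ω v' x) = optGen ω (kleinMul v v') x := by
  have hA : ∀ y : Ray, genA (genA y) = y := genA.left_inv
  have hk : ∀ i : Fin 3, optIsA i (kleinMul v v') = (optIsA i v != optIsA i v') := by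
    intro i
    rcases v with _ | v <;> rcases v' with _ | v' <;> (try cases v) <;> (try cases v') <;>
      fin_cases i <;> rfl
  funext n
  induction n generalizing ω x with
  | zero => simp only [optGen_zero]
  | succ n ih =>
    change (optGen ω v (optGen ω v' x)).tail n = (optGen ω (kleinMul v v') x).tail n
    simp only [optGen_tail, optGen_zero, hk]
    by_cases h : x 0
    · simp only [h, if_true]; exact ih _ _
    · cases optIsA (ω 0) v <;> cases optIsA (ω 0) v' <;> simp [h, hA]

theorem optGen_rho (ω : ℕ → Fin 3) (v : Option Letter) : optGen ω v rho = rho := by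
  cases v with
  | none => rfl
  | some v => exact genFun_rho v ω

theorem optGen_self (ω : ℕ → Fin 3) (v : Option Letter) (x : Ray) :
    optGen ω v (optGen ω v x) = x := by
  cases v with
  | none => rfl
  | some v => exact genFun_genFun v ω x

theorem optGen_eq_rho (ω : ℕ → Fin 3) (v : Option Letter) (x : Ray) :
    optGen ω v x = rho ↔ x = rho := by
  refine ⟨fun h => ?_, fun h => by rw [h, optGen_rho]⟩
  rw [← optGen_self ω v x, h, optGen_rho]

open Classical in
/-- The map `(x, t) ↦ (v x, φ_f(v x) t)`. -/
def lampFun {F : Type*} [Group F] (ω : ℕ → Fin 3) (s : Option Letter × F) (z : Ray × F) :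
    Ray × F :=
  (optGen ω s.1 z.1, if z.1 = rho then s.2 * z.2 else z.2)

theorem lampFun_lampFun {F : Type*} [Group F] (ω : ℕ → Fin 3) (s s' : Option Letter × F)
    (z : Ray × F) :
    lampFun ω s (lampFun ω s' z) = lampFun ω (kleinMul s.1 s'.1, s.2 * s'.2) z := by
  by_cases h : z.1 = rho <;> simp [lampFun, optGen_optGen, optGen_eq_rho, h, mul_assoc]

theorem lampFun_one {F : Type*} [Group F] (ω : ℕ → Fin 3) (z : Ray × F) :
    lampFun ω (none, 1) z = z := by
  simp [lampFun, optGen]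

theorem kleinMul_self (v : Option Letter) : kleinMul v v = none := by
  rcases v with _ | v
  · rfl
  · cases v <;> rfl

/-- The action of `φ_f v` on `∂T × F`. -/
def lampGen {F : Type*} [Group F] (ω : ℕ → Fin 3) (s : Option Letter × F) : LampPerm F where
  toFun := lampFun ω s
  invFun := lampFun ω (s.1, s.2⁻¹)
  left_inv z := by rw [lampFun_lampFun]; simp [kleinMul_self, lampFun_one]
  right_inv z := by rw [lampFun_lampFun]; simp [kleinMul_self, lampFun_one]

theorem lampGen_mul {F : Type*} [Group F] (ω : ℕ → Fin 3) (s s' : Option Letter × F) :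
    lampGen ω s * lampGen ω s' = lampGen ω (kleinMul s.1 s'.1, s.2 * s'.2) :=
  Equiv.ext fun z => lampFun_lampFun ω s s' z

theorem lampGen_one {F : Type*} [Group F] (ω : ℕ → Fin 3) :
    lampGen ω (none, (1 : F)) = 1 :=
  Equiv.ext fun z => lampFun_one ω z

/-- `a` or the identity. -/
def bitA (F : Type*) (i : Bool) : LampPerm F := if i then swapA F else 1

@[simp] theorem bitA_true (F : Type*) : bitA F true = swapA F := rfl

@[simp] theorem bitA_false (F : Type*) : bitA F false = 1 := rfl

theorem swapA_mul_bitA {F : Type*} (i : Bool) : swapA F * bitA F i = bitA F (!i) := by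
  cases i <;> simp [swapA_mul_self]

theorem lampGen_eq_node {F : Type*} [Group F] (ω : ℕ → Fin 3) (s : Option Letter × F) :
    lampGen ω s = node (bitA F (optIsA (ω 0) s.1)) (lampGen (shift ω) s) := by
  refine Equiv.ext fun ⟨x, t⟩ => ?_
  obtain ⟨i, y, rfl⟩ : ∃ i y, x = Ray.cons i y := ⟨_, _, (Ray.cons_eta x).symm⟩
  refine Prod.ext (Ray.ext_head_tail ?_ ?_) ?_
  · simp [lampGen, lampFun, node, nodeFun, optGen_zero]
  · cases i
    · cases h : optIsA (ω 0) s.1 <;>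
        simp [lampGen, lampFun, node, nodeFun, optGen_tail, swapA, h]
    · simp [lampGen, lampFun, node, nodeFun, optGen_tail]
  · cases i
    · cases h : optIsA (ω 0) s.1 <;>
        simp [lampGen, lampFun, node, nodeFun, Ray.cons_eq_rho, swapA]
    · by_cases h : y = rho <;> simp [lampGen, lampFun, node, nodeFun, Ray.cons_eq_rho, h]

theorem lampGen_injective {F : Type*} [Group F] (ω : ℕ → Fin 3) (v : Option Letter) {f f' : F}
    (h : lampGen ω (v, f) = lampGen ω (v, f')) : f = f' := by
  have := congrArg Prod.snd (Equiv.congr_fun h (rho, 1))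
  simpa [lampGen, lampFun] using this

/-- The images of the generators of `Γ_ω` in the group of permutations of `∂T × F`. -/
def permGenSet (F : Type*) [Group F] (ω : ℕ → Fin 3) : Set (LampPerm F) :=
  {swapA F} ∪ Set.range (lampGen ω)

open Classical in
/-- The extension by the identity of a function on the orbit of `ρ`. -/
def lampExt {F : Type*} [Group F] {ω : ℕ → Fin 3} (φ : FinSupp F (Orb ω)) (x : Ray) : F :=
  if h : x ∈ MulAction.orbit (GOmega ω) rho then φ.1 ⟨x, h⟩ else 1

theorem lampExt_of_mem {F : Type*} [Group F] {ω : ℕ → Fin 3} (φ : FinSupp F (Orb ω)) {x : Ray}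
    (h : x ∈ MulAction.orbit (GOmega ω) rho) : lampExt φ x = φ.1 ⟨x, h⟩ := dif_pos h

theorem lampExt_of_notMem {F : Type*} [Group F] {ω : ℕ → Fin 3} (φ : FinSupp F (Orb ω)) {x : Ray}
    (h : x ∉ MulAction.orbit (GOmega ω) rho) : lampExt φ x = 1 := dif_neg h

theorem lampExt_one {F : Type*} [Group F] {ω : ℕ → Fin 3} (x : Ray) :
    lampExt (1 : FinSupp F (Orb ω)) x = 1 := by
  by_cases h : x ∈ MulAction.orbit (GOmega ω) rho
  · rw [lampExt_of_mem _ h]; rfl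
  · rw [lampExt_of_notMem _ h]

theorem mem_orbit_apply {ω : ℕ → Fin 3} (g : GOmega ω) (x : Ray) :
    g.1 x ∈ MulAction.orbit (GOmega ω) rho ↔ x ∈ MulAction.orbit (GOmega ω) rho := by
  constructor
  · intro h
    have := MulAction.mem_orbit_of_mem_orbit g⁻¹ h
    rwa [show g⁻¹ • g.1 x = x from inv_smul_smul g x] at this
  · exact fun h => MulAction.mem_orbit_of_mem_orbit g h

theorem lampExt_mul_lampAction {F : Type*} [Group F] {ω : ℕ → Fin 3} (φ ψ : FinSupp F (Orb ω))
    (g : GOmega ω) (x : Ray) :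
    lampExt (φ * lampAction F (Orb ω) (GOmega ω) g ψ) (g.1 x) =
      lampExt φ (g.1 x) * lampExt ψ x := by
  by_cases h : x ∈ MulAction.orbit (GOmega ω) rho
  · have h1 := (mem_orbit_apply g x).2 h
    rw [lampExt_of_mem _ h, lampExt_of_mem _ h1, lampExt_of_mem _ h1]
    change φ.1 _ * ψ.1 (g⁻¹ • (⟨g.1 x, h1⟩ : Orb ω)) = _
    rw [show g⁻¹ • (⟨g.1 x, h1⟩ : Orb ω) = ⟨x, h⟩ from inv_smul_smul g (⟨x, h⟩ : Orb ω)]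
  · have h1 := fun h' => h ((mem_orbit_apply g x).1 h')
    rw [lampExt_of_notMem _ h, lampExt_of_notMem _ h1, lampExt_of_notMem _ h1, mul_one]

theorem lampExt_single {F : Type*} [Group F] {ω : ℕ → Fin 3} (f : F) (x : Ray) [Decidable (x = rho)] :
    lampExt (single (rhoOrb ω) f) x = if x = rho then f else 1 := by
  by_cases h : x ∈ MulAction.orbit (GOmega ω) rho
  · rw [lampExt_of_mem _ h]
    simp [single, Pi.mulSingle_apply, rhoOrb]
  · have hx : x ≠ rho := fun hx => h (hx ▸ MulAction.mem_orbit_self _)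
    rw [lampExt_of_notMem _ h, if_neg hx]

/-- The action of `φ g` on `∂T × F`: `(x, t) ↦ (g x, φ(g x) t)`. -/
def gamFun {F : Type*} [Group F] {ω : ℕ → Fin 3} (γ : Gam F ω) (z : Ray × F) : Ray × F :=
  (γ.right.1 z.1, lampExt γ.left (γ.right.1 z.1) * z.2)

theorem gamFun_mul {F : Type*} [Group F] {ω : ℕ → Fin 3} (γ δ : Gam F ω) (z : Ray × F) :
    gamFun (γ * δ) z = gamFun γ (gamFun δ z) := by
  refine Prod.ext rfl ?_
  change lampExt (γ.left * _) (γ.right.1 (δ.right.1 z.1)) * z.2 = _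
  rw [lampExt_mul_lampAction, mul_assoc]
  rfl

theorem gamFun_one {F : Type*} [Group F] {ω : ℕ → Fin 3} (z : Ray × F) :
    gamFun (1 : Gam F ω) z = z := by
  refine Prod.ext rfl ?_
  change lampExt (1 : FinSupp F (Orb ω)) _ * z.2 = z.2
  rw [lampExt_one, one_mul]

/-- The embedding of `Γ_ω` in the group of permutations of `∂T × F`. -/
def gamHom (F : Type*) [Group F] (ω : ℕ → Fin 3) : Gam F ω →* LampPerm F where
  toFun γ :=
    { toFun := gamFun γ
      invFun := gamFun γ⁻¹
      left_inv := fun z => by rw [← gamFun_mul, inv_mul_cancel, gamFun_one]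
      right_inv := fun z => by rw [← gamFun_mul, mul_inv_cancel, gamFun_one] }
  map_one' := Equiv.ext gamFun_one
  map_mul' γ δ := Equiv.ext fun z => gamFun_mul γ δ z

theorem gamHom_injective (F : Type*) [Group F] (ω : ℕ → Fin 3) :
    Function.Injective (gamHom F ω) := by
  rw [injective_iff_map_eq_one]
  intro γ h
  have h1 : ∀ z, gamFun γ z = z := fun z => Equiv.congr_fun h z
  have hr : γ.right = 1 := Subtype.ext (Equiv.ext fun x => congrArg Prod.fst (h1 (x, 1)))
  refine SemidirectProduct.ext (Subtype.ext (funext fun x => ?_)) hr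
  have := congrArg Prod.snd (h1 (x.1, 1))
  simp only [gamFun, hr, mul_one] at this
  exact (lampExt_of_mem γ.left x.2).symm.trans this

theorem gamHom_image_genSet (F : Type*) [Group F] (ω : ℕ → Fin 3) :
    gamHom F ω '' genSet F ω = permGenSet F ω := by
  have hA : gamHom F ω (SemidirectProduct.inr (elA ω)) = swapA F := by
    refine Equiv.ext fun z => Prod.ext rfl ?_
    change lampExt (1 : FinSupp F (Orb ω)) _ * z.2 = z.2
    rw [lampExt_one, one_mul]
  have hE : ∀ (f : F) (g : GOmega ω) (v : Option Letter), (∀ x, g.1 x = optGen ω v x) →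
      gamHom F ω (SemidirectProduct.inl (single (rhoOrb ω) f) * SemidirectProduct.inr g) =
        lampGen ω (v, f) := by
    intro f g v hg
    classical
    refine Equiv.ext fun z => Prod.ext ?_ ?_
    · simp [gamHom, gamFun, lampGen, lampFun, hg]
    · change lampExt (single (rhoOrb ω) f * lampAction F (Orb ω) (GOmega ω) 1 1) _ * z.2 =
        (lampFun ω (v, f) z).2
      rw [map_one, mul_one, lampExt_single]
      by_cases h : z.1 = rho
      · simp [hg, lampFun, h, optGen_rho]
      · simp [hg, lampFun, h, optGen_eq_rho]
  have hv : ∀ v ∈ ({1, el .b ω, el .c ω, el .d ω} : Set (GOmega ω)),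
      ∃ v' : Option Letter, ∀ x, v.1 x = optGen ω v' x := by
    intro v hv
    simp only [Set.mem_insert_iff, Set.mem_singleton_iff] at hv
    rcases hv with rfl | rfl | rfl | rfl
    exacts [⟨none, fun x => rfl⟩, ⟨some .b, fun x => rfl⟩, ⟨some .c, fun x => rfl⟩,
      ⟨some .d, fun x => rfl⟩]
  rw [genSet, permGenSet, Set.image_union, Set.image_singleton, hA]
  congr 1
  ext g
  constructor
  · rintro ⟨_, ⟨f, v, hv', rfl⟩, rfl⟩
    obtain ⟨v', h⟩ := hv v hv'
    exact ⟨(v', f), (hE f v v' h).symm⟩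
  · rintro ⟨⟨v, f⟩, rfl⟩
    rcases v with _ | v
    · exact ⟨_, ⟨f, 1, by simp, rfl⟩, hE f 1 none fun x => rfl⟩
    · exact ⟨_, ⟨f, el v ω, by cases v <;> simp, rfl⟩, hE f _ (some v) fun x => rfl⟩

theorem bOmega_eq_ncard (F : Type*) [Group F] (ω : ℕ → Fin 3) (r : ℕ) :
    bOmega F ω r = (permGenSet F ω ^ r).ncard := by
  rw [bOmega, growth, ← gamHom_image_genSet, ← Set.image_pow,
    Set.ncard_image_of_injective _ (gamHom_injective F ω)]

/-! The weights that govern the growth of `Γ_ω`, and the lower bound. -/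

/-- The sum of the three values of a weight. -/
def total (p : Letter → ℕ) : ℕ := p .b + p .c + p .d

/-- The change of weights at a level of the tree with letter `i`. -/
def weightStep (i : Fin 3) (p : Letter → ℕ) (v : Letter) : ℕ :=
  if uIsA v i then 2 * p v else total p

/-- The weights at the level `k`, starting from the weights `p`. -/
def weight (p : Letter → ℕ) : (ℕ → Fin 3) → ℕ → Letter → ℕ
  | _, 0 => p
  | ω, k + 1 => weight (weightStep (ω 0) p) (shift ω) k

theorem weight_succ (p : Letter → ℕ) (ω : ℕ → Fin 3) (k : ℕ) :
    weight p ω (k + 1) = weightStep (ω k) (weight p ω k) := by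
  induction k generalizing p ω with
  | zero => rfl
  | succ k ih => rw [weight, ih]; rfl

/-- The product of the elements `a φ_f v`. -/
def pairsProd {F : Type*} [Group F] (ω : ℕ → Fin 3) (l : List (Option Letter × F)) : LampPerm F :=
  (l.map fun s => swapA F * lampGen ω s).prod

theorem pairsProd_cons {F : Type*} [Group F] (ω : ℕ → Fin 3) (s : Option Letter × F)
    (l : List (Option Letter × F)) :
    pairsProd ω (s :: l) = swapA F * (lampGen ω s * pairsProd ω l) := by
  simp [pairsProd, mul_assoc]

/-- The elements represented by a word `w` in the letters `b, c, d` with arbitrary lamps. -/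
def wordSet (F : Type*) [Group F] (ω : ℕ → Fin 3) (w : List Letter) : Set (LampPerm F) :=
  {g | ∃ l : List (Option Letter × F), l.map Prod.fst = w.map some ∧ pairsProd ω l = g}

theorem wordSet_nil (F : Type*) [Group F] (ω : ℕ → Fin 3) : wordSet F ω [] = {1} := by
  ext g
  constructor
  · rintro ⟨l, hl, rfl⟩
    have : l = [] := by simpa using hl
    subst this; rfl
  · rintro rfl
    exact ⟨[], rfl, rfl⟩

theorem mem_wordSet_cons {F : Type*} [Group F] {ω : ℕ → Fin 3} {v : Letter} {w : List Letter}
    {g : LampPerm F} : g ∈ wordSet F ω (v :: w) ↔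
      ∃ f : F, ∃ h ∈ wordSet F ω w, swapA F * (lampGen ω (some v, f) * h) = g := by
  constructor
  · rintro ⟨l, hl, rfl⟩
    rcases l with _ | ⟨⟨v', f⟩, l⟩
    · simp at hl
    · simp only [List.map_cons, List.cons.injEq] at hl
      obtain ⟨rfl, hl⟩ := hl
      exact ⟨f, _, ⟨l, hl, rfl⟩, (pairsProd_cons _ _ _).symm⟩
  · rintro ⟨f, _, ⟨l, hl, rfl⟩, rfl⟩
    exact ⟨(some v, f) :: l, by simp [hl], pairsProd_cons _ _ _⟩

theorem wordSet_subset (F : Type*) [Group F] (ω : ℕ → Fin 3) (w : List Letter) :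
    wordSet F ω w ⊆ permGenSet F ω ^ (2 * w.length) := by
  induction w with
  | nil => simp [wordSet_nil]
  | cons v w ih =>
    intro g hg
    obtain ⟨f, h, hh, rfl⟩ := mem_wordSet_cons.1 hg
    rw [List.length_cons, mul_add, mul_one, pow_add, (Commute.pow_pow_self _ _ _).eq, pow_two,
      ← mul_assoc]
    exact Set.mul_mem_mul (Set.mul_mem_mul (Or.inl rfl) (Or.inr ⟨_, rfl⟩)) (ih hh)

theorem permGenSet_finite (F : Type*) [Group F] [Finite F] (ω : ℕ → Fin 3) :
    (permGenSet F ω).Finite := by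
  rw [← gamHom_image_genSet]
  exact (genSet_finite F ω).image _

theorem permGenSet_pow_finite (F : Type*) [Group F] [Finite F] (ω : ℕ → Fin 3) (r : ℕ) :
    (permGenSet F ω ^ r).Finite := by
  induction r with
  | zero => simp
  | succ r ih => rw [pow_succ]; exact ih.mul (permGenSet_finite F ω)

theorem wordSet_finite (F : Type*) [Group F] [Finite F] (ω : ℕ → Fin 3) (w : List Letter) :
    (wordSet F ω w).Finite :=
  (permGenSet_pow_finite F ω _).subset (wordSet_subset F ω w)

/-- The two letters different from a given one. -/
def otherLetters : Letter → Letter × Letter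
  | .b => (.c, .d)
  | .c => (.b, .d)
  | .d => (.b, .c)

/-- The substitution that lifts a word from the subtrees of the root. -/
def liftLetter (i : Fin 3) (v : Letter) : List Letter :=
  if uIsA v i then [v, v] else [(otherLetters v).1, v, (otherLetters v).2]

/-- The lift of a word from the subtrees of the root. -/
def liftWord (i : Fin 3) (w : List Letter) : List Letter := w.flatMap (liftLetter i)

theorem sum_liftWord (i : Fin 3) (p : Letter → ℕ) (w : List Letter) :
    ((liftWord i w).map p).sum = (w.map (weightStep i p)).sum := by
  induction w with
  | nil => rfl
  | cons v w ih =>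
    have h : ((liftLetter i v).map p).sum = weightStep i p v := by
      cases hu : uIsA v i
      · cases v <;> simp [liftLetter, weightStep, hu, otherLetters, total] <;> ring
      · simp [liftLetter, weightStep, hu]; ring
    rw [liftWord] at ih
    simp [liftWord, h, ih]

theorem uIsA_other {i : Fin 3} {v : Letter} (h : uIsA v i = false) :
    uIsA (otherLetters v).1 i = true ∧ uIsA (otherLetters v).2 i = true := by
  revert h
  fin_cases i <;> cases v <;> decide

theorem kleinMul_other (v : Letter) :
    kleinMul (some (otherLetters v).1) (some (otherLetters v).2) = some v := by
  cases v <;> rfl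

/-- The parity of the number of letters of the lift of a word. -/
def liftParity (i : Fin 3) : List Letter → Bool
  | [] => false
  | v :: w => if uIsA v i then liftParity i w else !(liftParity i w)

theorem node_mem_wordSet {F : Type*} [Group F] (ω : ℕ → Fin 3) (w : List Letter)
    {g h : LampPerm F} (hg : g ∈ wordSet F (shift ω) w) (hh : h ∈ wordSet F (shift ω) w) :
    node (swapA F * (g * bitA F (!(liftParity (ω 0) w)))) (h * bitA F (liftParity (ω 0) w)) *
      bitA F (liftParity (ω 0) w) ∈ wordSet F ω (liftWord (ω 0) w) := by
  induction w generalizing g h with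
  | nil =>
    rw [wordSet_nil] at hg hh
    rw [Set.mem_singleton_iff.1 hg, Set.mem_singleton_iff.1 hh]
    simp [liftParity, liftWord, wordSet_nil, swapA_mul_self, node_one]
  | cons v w ih =>
    obtain ⟨f₁, g, hg', rfl⟩ := mem_wordSet_cons.1 hg
    obtain ⟨f₂, h, hh', rfl⟩ := mem_wordSet_cons.1 hh
    cases hu : uIsA v (ω 0)
    · obtain ⟨h1, h2⟩ := uIsA_other hu
      have key := ih hh' hg'
      rw [liftWord, List.flatMap_cons, liftLetter, hu, ← liftWord]
      simp only [Bool.false_eq_true, if_false, List.cons_append, List.nil_append, liftParity, hu,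
        Bool.not_not]
      refine mem_wordSet_cons.2 ⟨f₁, _, mem_wordSet_cons.2 ⟨f₂, _, mem_wordSet_cons.2
        ⟨1, _, key, rfl⟩, rfl⟩, ?_⟩
      simp only [lampGen_eq_node ω, optIsA, h1, h2, hu, bitA_true, bitA_false, node_mul_node_mul,
        swapA_mul_node_mul, swapA_mul_bitA, swapA_mul_swapA_mul, mul_assoc, one_mul]
      rw [← mul_assoc (lampGen (shift ω) _) (lampGen (shift ω) _), lampGen_mul, kleinMul_other,
        mul_one, Bool.not_not]
    · have key := ih hg' hh'
      rw [liftWord, List.flatMap_cons, liftLetter, hu, ← liftWord]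
      simp only [if_true, List.cons_append, List.nil_append, liftParity, hu]
      refine mem_wordSet_cons.2 ⟨f₁, _, mem_wordSet_cons.2 ⟨f₂, _, key, rfl⟩, ?_⟩
      simp only [lampGen_eq_node ω, optIsA, hu, bitA_true, node_mul_node_mul,
        swapA_mul_node_mul, swapA_mul_swapA_mul, mul_assoc]

theorem ncard_wordSet_liftWord (F : Type*) [Group F] [Finite F] (ω : ℕ → Fin 3)
    (w : List Letter) :
    (wordSet F (shift ω) w).ncard ^ 2 ≤ (wordSet F ω (liftWord (ω 0) w)).ncard := by
  rw [pow_two, ← Set.ncard_prod]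
  refine Set.ncard_le_ncard_of_injOn (fun z =>
    node (swapA F * (z.1 * bitA F (!(liftParity (ω 0) w)))) (z.2 * bitA F (liftParity (ω 0) w)) *
      bitA F (liftParity (ω 0) w)) (fun z hz => node_mem_wordSet ω w hz.1 hz.2) ?_
    (wordSet_finite F ω _)
  intro z _ z' _ h
  obtain ⟨h1, h2⟩ := node_inj (mul_right_cancel h)
  exact Prod.ext (mul_right_cancel (mul_left_cancel h1)) (mul_right_cancel h2)

theorem ncard_wordSet_weight (F : Type*) [Group F] [Finite F] (ω : ℕ → Fin 3) (k : ℕ)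
    (w : List Letter) :
    ∃ w' : List Letter, w'.length = (w.map (weight 1 ω k)).sum ∧
      (wordSet F (fun n => ω (n + k)) w).ncard ^ 2 ^ k ≤ (wordSet F ω w').ncard := by
  induction k generalizing w with
  | zero => exact ⟨w, by simp [weight, Pi.one_def], by simp⟩
  | succ k ih =>
    obtain ⟨w', h1, h2⟩ := ih (liftWord (ω k) w)
    refine ⟨w', by rw [h1, sum_liftWord, ← weight_succ], le_trans ?_ h2⟩
    have h3 := ncard_wordSet_liftWord F (fun n => ω (n + k)) w
    have h4 : shift (fun n => ω (n + k)) = fun n => ω (n + (k + 1)) := by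
      funext n; simp only [shift]; congr 1; ring
    rw [h4, zero_add] at h3
    calc _ = ((wordSet F (fun n => ω (n + (k + 1))) w).ncard ^ 2) ^ 2 ^ k := by
          rw [← pow_mul]; congr 1; ring
      _ ≤ _ := Nat.pow_le_pow_left h3 _

theorem card_le_ncard_wordSet_singleton (F : Type*) [Group F] [Finite F] (ω : ℕ → Fin 3)
    (v : Letter) : Nat.card F ≤ (wordSet F ω [v]).ncard := by
  rw [← Set.ncard_univ]
  refine Set.ncard_le_ncard_of_injOn (fun f => swapA F * (lampGen ω (some v, f) * 1))
    (fun f _ => mem_wordSet_cons.2 ⟨f, 1, by simp [wordSet_nil], rfl⟩) ?_ (wordSet_finite F ω _)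
  intro f _ f' _ h
  exact lampGen_injective ω _ (mul_right_cancel (mul_left_cancel h))

/-- The lower bound for the growth function of `Γ_ω`. -/
theorem card_pow_le_bOmega (F : Type*) [Group F] [Finite F] (ω : ℕ → Fin 3) (k : ℕ)
    (v : Letter) : Nat.card F ^ 2 ^ k ≤ bOmega F ω (2 * weight 1 ω k v) := by
  obtain ⟨w, h1, h2⟩ := ncard_wordSet_weight F ω k [v]
  have h3 : w.length = weight 1 ω k v := by simpa using h1
  rw [bOmega_eq_ncard, ← h3]
  exact (Nat.pow_le_pow_left (card_le_ncard_wordSet_singleton F _ v) _).trans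
    (h2.trans (Set.ncard_le_ncard (wordSet_subset F ω w) (permGenSet_pow_finite F ω _)))

theorem bOmega_mono (F : Type*) [Group F] [Finite F] (ω : ℕ → Fin 3) : Monotone (bOmega F ω) := by
  intro r r' h
  rw [bOmega_eq_ncard, bOmega_eq_ncard]
  refine Set.ncard_le_ncard (Set.pow_subset_pow_right ?_ h) (permGenSet_pow_finite F ω _)
  exact Or.inr ⟨(none, 1), lampGen_one ω⟩

/-! The upper bound. -/

/-- The smallest value of a weight. -/
def minWeight (p : Letter → ℕ) : ℕ := min (p .b) (min (p .c) (p .d))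

/-- The triangle inequalities. -/
def IsTriangle (p : Letter → ℕ) : Prop :=
  p .b ≤ p .c + p .d ∧ p .c ≤ p .b + p .d ∧ p .d ≤ p .b + p .c

theorem IsTriangle.weightStep {p : Letter → ℕ} (h : IsTriangle p) (i : Fin 3) :
    IsTriangle (weightStep i p) := by
  obtain ⟨h1, h2, h3⟩ := h
  fin_cases i <;> simp [IsTriangle, GrowthGroups.weightStep, uIsA, total] <;> omega

theorem two_mul_le_weightStep {p : Letter → ℕ} (h : IsTriangle p) (i : Fin 3) (v : Letter) :
    2 * p v ≤ weightStep i p v := by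
  obtain ⟨h1, h2, h3⟩ := h
  fin_cases i <;> cases v <;> simp [GrowthGroups.weightStep, uIsA, total] <;> omega

theorem two_mul_minWeight_le {p : Letter → ℕ} (h : IsTriangle p) (i : Fin 3) :
    2 * minWeight p ≤ minWeight (weightStep i p) := by
  have hb := two_mul_le_weightStep h i .b
  have hc := two_mul_le_weightStep h i .c
  have hd := two_mul_le_weightStep h i .d
  simp only [minWeight]
  omega

/-- The weight of `a` below a level of the tree with letter `i` and weights `p`. -/
def aWeight (i : Fin 3) (p : Letter → ℕ) : ℕ :=
  (![p .b + p .c - p .d, p .b + p .d - p .c, p .c + p .d - p .b] : Fin 3 → ℕ) i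

/-- The weight of the pair `a φ_f v`. -/
def pairWeight {F : Type*} (p : Letter → ℕ) (s : Option Letter × F) : ℕ :=
  s.1.elim (minWeight p) p

/-- The weight of a list of pairs. -/
def pairsWeight {F : Type*} (p : Letter → ℕ) (l : List (Option Letter × F)) : ℕ :=
  (l.map (pairWeight p)).sum

/-- The element represented by a letter; `none` stands for `a`. -/
def letterEval {F : Type*} [Group F] (ω : ℕ → Fin 3) : Option (Option Letter × F) → LampPerm F
  | none => swapA F
  | some s => lampGen ω s

/-- The weight of a letter of which `a` has weight `m`. -/
def letterWeight {F : Type*} (m : ℕ) (p : Letter → ℕ) : Option (Option Letter × F) → ℕ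
  | none => m
  | some s => pairWeight p s - m

theorem aWeight_le_minWeight {p : Letter → ℕ} (h : IsTriangle p) (i : Fin 3) :
    aWeight i p ≤ minWeight (weightStep i p) := by
  obtain ⟨h1, h2, h3⟩ := h
  fin_cases i <;> simp [aWeight, minWeight, weightStep, uIsA, total] <;> omega

theorem minWeight_le_pairWeight {F : Type*} (p : Letter → ℕ) (s : Option Letter × F) :
    minWeight p ≤ pairWeight p s := by
  obtain ⟨_ | v, f⟩ := s
  · exact le_rfl
  · cases v <;> simp [pairWeight, minWeight]

theorem child_weight_le {F : Type*} {p : Letter → ℕ} (h : IsTriangle p) (i : Fin 3)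
    (s : Option Letter × F) :
    letterWeight (aWeight i p) (weightStep i p) (some s) +
      (if optIsA i s.1 then aWeight i p else 0) ≤ 2 * pairWeight p s := by
  obtain ⟨h1, h2, h3⟩ := h
  obtain ⟨_ | v, f⟩ := s
  · fin_cases i <;>
      simp [letterWeight, pairWeight, aWeight, minWeight, weightStep, uIsA, total, optIsA] <;> omega
  · fin_cases i <;> cases v <;>
      simp [letterWeight, pairWeight, aWeight, weightStep, uIsA, total, optIsA] <;> omega

theorem weightStep_add_aWeight_le {p : Letter → ℕ} (h : IsTriangle p) (i : Fin 3) :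
    weightStep i p .b + aWeight i p ≤ weightStep i p .c + weightStep i p .d ∧
    weightStep i p .c + aWeight i p ≤ weightStep i p .b + weightStep i p .d ∧
    weightStep i p .d + aWeight i p ≤ weightStep i p .b + weightStep i p .c := by
  obtain ⟨h1, h2, h3⟩ := h
  fin_cases i <;> simp [aWeight, weightStep, uIsA, total] <;> omega

theorem letterWeight_kleinMul_le {F : Type*} [Group F] {p : Letter → ℕ} (h : IsTriangle p)
    (i : Fin 3) (s s' : Option Letter × F) :
    letterWeight (aWeight i p) (weightStep i p) (some (kleinMul s.1 s'.1, s.2 * s'.2)) ≤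
      letterWeight (aWeight i p) (weightStep i p) (some s) +
        letterWeight (aWeight i p) (weightStep i p) (some s') := by
  have h0 := aWeight_le_minWeight h i
  obtain ⟨h1, h2, h3⟩ := weightStep_add_aWeight_le h i
  generalize aWeight i p = m at *
  generalize weightStep i p = q at *
  obtain ⟨_ | v, f⟩ := s <;> obtain ⟨_ | v', f'⟩ := s'
  · simp [letterWeight, pairWeight, kleinMul]
  · simp [letterWeight, pairWeight, kleinMul]
  · cases v <;> simp [letterWeight, pairWeight, kleinMul]
  · simp only [minWeight] at h0
    cases v <;> cases v' <;>
      simp only [letterWeight, pairWeight, minWeight, kleinMul, Option.elim_none,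
        Option.elim_some] <;>
      omega

/-- The element represented by a word. -/
def wordEval {F : Type*} [Group F] (ω : ℕ → Fin 3) (x : List (Option (Option Letter × F))) :
    LampPerm F := (x.map (letterEval ω)).prod

/-- The weight of a word. -/
def wordWeight {F : Type*} (m : ℕ) (p : Letter → ℕ) (x : List (Option (Option Letter × F))) : ℕ :=
  (x.map (letterWeight m p)).sum

/-- Words can be reduced to alternating words without increasing the weight. -/
theorem exists_alternating {F : Type*} [Group F] {p : Letter → ℕ} (h : IsTriangle p) (i : Fin 3)
    (ω : ℕ → Fin 3) (x : List (Option (Option Letter × F))) :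
    ∃ (t : Bool) (l : List (Option Letter × F)),
      (wordEval ω x = pairsProd ω l * bitA F t ∧
        pairsWeight (weightStep i p) l + (if t then aWeight i p else 0) ≤
          wordWeight (aWeight i p) (weightStep i p) x) ∨
      ∃ s, wordEval ω x = lampGen ω s * (pairsProd ω l * bitA F t) ∧
        letterWeight (aWeight i p) (weightStep i p) (some s) + pairsWeight (weightStep i p) l +
          (if t then aWeight i p else 0) ≤ wordWeight (aWeight i p) (weightStep i p) x := by
  have hA : ∀ s : Option Letter × F, letterWeight (aWeight i p) (weightStep i p) (some s) +
      aWeight i p = pairWeight (weightStep i p) s := fun s =>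
    Nat.sub_add_cancel ((aWeight_le_minWeight h i).trans (minWeight_le_pairWeight _ s))
  induction x with
  | nil => exact ⟨false, [], Or.inl ⟨by simp [wordEval, pairsProd], by simp [pairsWeight]⟩⟩
  | cons y x ih =>
    have hx : wordEval ω (y :: x) = letterEval ω y * wordEval ω x := by simp [wordEval]
    have hw : wordWeight (aWeight i p) (weightStep i p) (y :: x) =
      letterWeight (aWeight i p) (weightStep i p) y +
        wordWeight (aWeight i p) (weightStep i p) x := by simp [wordWeight]
    obtain ⟨t, l, ⟨h1, h2⟩ | ⟨s, h1, h2⟩⟩ := ih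
    · cases y with
      | none =>
        cases l with
        | nil =>
          refine ⟨!t, [], Or.inl ⟨?_, ?_⟩⟩
          · rw [hx, h1]
            simp [letterEval, pairsProd, swapA_mul_bitA]
          · rw [hw]
            cases t <;> simp [letterWeight, pairsWeight]
        | cons s l =>
          refine ⟨t, l, Or.inr ⟨s, ?_, ?_⟩⟩
          · rw [hx, h1, pairsProd_cons, letterEval, mul_assoc, swapA_mul_swapA_mul, mul_assoc]
          · rw [hw]
            have := hA s
            simp only [pairsWeight, List.map_cons, List.sum_cons] at h2 ⊢
            omega
      | some s =>
        refine ⟨t, l, Or.inr ⟨s, by rw [hx, h1, letterEval], ?_⟩⟩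
        rw [hw]; omega
    · cases y with
      | none =>
        refine ⟨t, s :: l, Or.inl ⟨?_, ?_⟩⟩
        · rw [hx, h1, pairsProd_cons, letterEval]; simp only [mul_assoc]
        · rw [hw]
          have := hA s
          simp only [pairsWeight, List.map_cons, List.sum_cons, letterWeight] at *
          omega
      | some s' =>
        refine ⟨t, l, Or.inr ⟨(kleinMul s'.1 s.1, s'.2 * s.2), ?_, ?_⟩⟩
        · rw [hx, h1, letterEval, ← mul_assoc (lampGen ω s'), lampGen_mul]
        · have := letterWeight_kleinMul_le h i s' s
          rw [hw]; omega

theorem pairsProd_append {F : Type*} [Group F] (ω : ℕ → Fin 3) (l l' : List (Option Letter × F)) :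
    pairsProd ω (l ++ l') = pairsProd ω l * pairsProd ω l' := by
  simp [pairsProd]

theorem pairsProd_none {F : Type*} [Group F] (ω : ℕ → Fin 3) :
    pairsProd ω [(none, (1 : F))] = swapA F := by
  simp [pairsProd, lampGen_one]

theorem exists_pairs {F : Type*} [Group F] {p : Letter → ℕ} (h : IsTriangle p) (i : Fin 3)
    (ω : ℕ → Fin 3) (x : List (Option (Option Letter × F))) :
    ∃ l : List (Option Letter × F), pairsProd ω l = wordEval ω x ∧
      pairsWeight (weightStep i p) l ≤ wordWeight (aWeight i p) (weightStep i p) x +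
        3 * minWeight (weightStep i p) := by
  have hA := aWeight_le_minWeight h i
  have htail : ∀ (t : Bool) (l : List (Option Letter × F)), ∃ l' : List (Option Letter × F),
      pairsProd ω l' = pairsProd ω l * bitA F t ∧ pairsWeight (weightStep i p) l' ≤
        pairsWeight (weightStep i p) l + minWeight (weightStep i p) := by
    intro t l
    cases t
    · exact ⟨l, by simp, by simp⟩
    · refine ⟨l ++ [(none, 1)], by rw [pairsProd_append, pairsProd_none, bitA_true], ?_⟩
      simp [pairsWeight, pairWeight]
  obtain ⟨t, l, ⟨h1, h2⟩ | ⟨s, h1, h2⟩⟩ := exists_alternating h i ω x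
  · obtain ⟨l', h3, h4⟩ := htail t l
    exact ⟨l', by rw [h1, h3], by omega⟩
  · obtain ⟨l', h3, h4⟩ := htail t l
    refine ⟨(none, 1) :: s :: l', ?_, ?_⟩
    · rw [pairsProd_cons, pairsProd_cons, lampGen_one, one_mul, swapA_mul_swapA_mul, h1, h3]
    · have : pairWeight (weightStep i p) ((none, 1) : Option Letter × F) =
        minWeight (weightStep i p) := rfl
      simp only [pairsWeight, List.map_cons, List.sum_cons, letterWeight] at *
      omega

theorem exists_node_words {F : Type*} [Group F] {p : Letter → ℕ} (h : IsTriangle p)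
    (ω : ℕ → Fin 3) (l : List (Option Letter × F)) :
    ∃ (x y : List (Option (Option Letter × F))) (t : Bool),
      pairsProd ω l = node (wordEval (shift ω) x) (wordEval (shift ω) y) * bitA F t ∧
      wordWeight (aWeight (ω 0) p) (weightStep (ω 0) p) x +
        wordWeight (aWeight (ω 0) p) (weightStep (ω 0) p) y ≤ 2 * pairsWeight p l := by
  induction l with
  | nil => exact ⟨[], [], false, by simp [pairsProd, wordEval, node_one], by simp [wordWeight]⟩
  | cons s l ih =>
    obtain ⟨x, y, t, h1, h2⟩ := ih
    have h3 := child_weight_le h (ω 0) s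
    refine ⟨some s :: y, (if optIsA (ω 0) s.1 then [none] else []) ++ x, !t, ?_, ?_⟩
    · rw [pairsProd_cons, h1, lampGen_eq_node, node_mul_node_mul, swapA_mul_node_mul,
        swapA_mul_bitA]
      cases optIsA (ω 0) s.1 <;> simp [wordEval, letterEval]
    · cases hu : optIsA (ω 0) s.1 <;>
        simp [hu, wordWeight, pairsWeight, letterWeight] at * <;> omega

/-- The elements described at the level `k` of the tree by pairs whose total number is `M`. -/
inductive Described (F : Type*) [Group F] : ℕ → (ℕ → Fin 3) → ℕ → LampPerm F → Prop
  | leaf (ω : ℕ → Fin 3) (l : List (Option Letter × F)) :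
      Described F 0 ω l.length (pairsProd ω l)
  | branch {k : ℕ} {ω : ℕ → Fin 3} {M N : ℕ} {P Q : LampPerm F} (t : Bool)
      (hP : Described F k (shift ω) M P) (hQ : Described F k (shift ω) N Q) :
      Described F (k + 1) ω (M + N) (node P Q * bitA F t)

theorem length_mul_le_pairsWeight {F : Type*} (p : Letter → ℕ) (l : List (Option Letter × F)) :
    l.length * minWeight p ≤ pairsWeight p l := by
  induction l with
  | nil => simp
  | cons s l ih =>
    have := minWeight_le_pairWeight p s
    simp only [pairsWeight, List.map_cons, List.sum_cons, List.length_cons, add_mul] at *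
    omega

theorem exists_described {F : Type*} [Group F] {p : Letter → ℕ} (h : IsTriangle p) (k : ℕ)
    (ω : ℕ → Fin 3) (l : List (Option Letter × F)) :
    ∃ M, Described F k ω M (pairsProd ω l) ∧
      M * minWeight (weight p ω k) + 2 ^ k * (6 * minWeight p) ≤
        2 ^ k * (pairsWeight p l + 6 * minWeight (weight p ω k)) := by
  induction k generalizing p ω l with
  | zero =>
    refine ⟨_, .leaf ω l, ?_⟩
    have := length_mul_le_pairsWeight p l
    simp only [weight, pow_zero, one_mul]
    omega
  | succ k ih =>
    obtain ⟨x, y, t, h1, h2⟩ := exists_node_words h ω l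
    obtain ⟨l₁, h3, h4⟩ := exists_pairs h (ω 0) (shift ω) x
    obtain ⟨l₂, h5, h6⟩ := exists_pairs h (ω 0) (shift ω) y
    obtain ⟨M, h7, h8⟩ := ih (h.weightStep (ω 0)) (shift ω) l₁
    obtain ⟨N, h9, h10⟩ := ih (h.weightStep (ω 0)) (shift ω) l₂
    refine ⟨M + N, ?_, ?_⟩
    · rw [h1, ← h3, ← h5]
      exact .branch t h7 h9
    · have h11 := two_mul_minWeight_le h (ω 0)
      have h12 : 2 ^ k * (pairsWeight (weightStep (ω 0) p) l₁ +
          pairsWeight (weightStep (ω 0) p) l₂ + 12 * minWeight p) ≤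
          2 ^ k * (2 * pairsWeight p l + 6 * minWeight (weightStep (ω 0) p)) +
            2 ^ k * (6 * minWeight (weightStep (ω 0) p)) := by
        rw [← mul_add]
        exact Nat.mul_le_mul_left _ (by omega)
      rw [weight]
      ring_nf at h8 h10 h12 ⊢
      omega

/-- Decoding of the elements that are described at the level `k`. -/
def decode {F : Type*} [Group F] : ℕ → (ℕ → Fin 3) → List (Option (Option Letter × F)) →
    LampPerm F × List (Option (Option Letter × F))
  | 0, _, [] => (1, [])
  | 0, _, none :: r => (1, r)
  | 0, ω, some s :: r => (swapA F * (lampGen ω s * (decode 0 ω r).1), (decode 0 ω r).2)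
  | _ + 1, _, [] => (1, [])
  | k + 1, ω, y :: r =>
    let P := decode k (shift ω) r
    let Q := decode k (shift ω) P.2
    (node P.1 Q.1 * bitA F y.isSome, Q.2)

theorem exists_code {F : Type*} [Group F] {k : ℕ} {ω : ℕ → Fin 3} {M : ℕ} {g : LampPerm F}
    (h : Described F k ω M g) :
    ∃ c : List (Option (Option Letter × F)), c.length + 1 = M + 2 ^ (k + 1) ∧
      ∀ r, decode k ω (c ++ r) = (g, r) := by
  induction h with
  | leaf ω l =>
    refine ⟨l.map some ++ [none], by simp, fun r => ?_⟩
    induction l with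
    | nil => simp [decode, pairsProd]
    | cons s l ih =>
      have : (List.map some (s :: l) ++ [none] : List (Option (Option Letter × F))) ++ r =
        some s :: ((List.map some l ++ [none]) ++ r) := by simp
      rw [this, decode, ih, pairsProd_cons]
  | @branch k ω M N P Q t hP hQ ihP ihQ =>
    obtain ⟨c, hc, hc'⟩ := ihP
    obtain ⟨d, hd, hd'⟩ := ihQ
    refine ⟨(if t then some (none, 1) else none) :: (c ++ d), ?_, fun r => ?_⟩
    · simp only [List.length_cons, List.length_append]
      rw [pow_succ]
      omega
    · rw [List.cons_append, List.append_assoc, decode, hc']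
      simp only [hd']
      cases t <;> simp

instance : Finite Letter :=
  Finite.of_injective (fun v : Letter => (⟨uIsA v 0, uIsA v 1⟩ : Bool × Bool)) (by
    intro v v'
    cases v <;> cases v' <;> simp [uIsA])

theorem described_finite_and_ncard_le (F : Type*) [Group F] [Finite F] (k : ℕ) (ω : ℕ → Fin 3)
    (L : ℕ) : {g | ∃ M ≤ L, Described F k ω M g}.Finite ∧
    {g | ∃ M ≤ L, Described F k ω M g}.ncard ≤
      Nat.card (Option (Option Letter × F)) ^ (L + 2 ^ (k + 1)) := by
  have hsub : {g | ∃ M ≤ L, Described F k ω M g} ⊆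
      (fun c : Fin (L + 2 ^ (k + 1)) → Option (Option Letter × F) =>
        (decode k ω (List.ofFn c)).1) '' Set.univ := by
    rintro g ⟨M, hM, hg⟩
    obtain ⟨c, hc, hc'⟩ := exists_code hg
    have hlen : (c ++ List.replicate (L + 2 ^ (k + 1) - c.length) none).length =
        L + 2 ^ (k + 1) := by
      simp only [List.length_append, List.length_replicate]; omega
    refine ⟨fun j => (c ++ List.replicate (L + 2 ^ (k + 1) - c.length) none).get
      (j.cast hlen.symm), trivial, ?_⟩
    have : List.ofFn (fun j : Fin (L + 2 ^ (k + 1)) =>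
        (c ++ List.replicate (L + 2 ^ (k + 1) - c.length) none).get (j.cast hlen.symm)) =
        c ++ List.replicate (L + 2 ^ (k + 1) - c.length) none := by
      rw [← List.ofFn_congr hlen]
      exact List.ofFn_get _
    simp only [this, hc']
  refine ⟨(Set.finite_univ.image _).subset hsub, ?_⟩
  calc _ ≤ _ := Set.ncard_le_ncard hsub (Set.finite_univ.image _)
    _ ≤ _ := Set.ncard_image_le Set.finite_univ
    _ = _ := by rw [Set.ncard_univ, Nat.card_fun, Nat.card_fin]

theorem exists_pairs_of_mem_pow {F : Type*} [Group F] (ω : ℕ → Fin 3) (r : ℕ) {g : LampPerm F}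
    (hg : g ∈ permGenSet F ω ^ r) : ∃ l : List (Option Letter × F), l.length ≤ 2 * r ∧
      pairsProd ω l = g := by
  induction r generalizing g with
  | zero =>
    rw [pow_zero, Set.mem_one] at hg
    exact ⟨[], by simp, by simp [pairsProd, hg]⟩
  | succ r ih =>
    rw [pow_succ'] at hg
    obtain ⟨y, hy, h, hh, rfl⟩ := Set.mem_mul.1 hg
    obtain ⟨l, hl, rfl⟩ := ih hh
    rcases hy with rfl | ⟨s, rfl⟩
    · exact ⟨(none, 1) :: l, by simp; omega, by rw [pairsProd_cons, lampGen_one, one_mul]⟩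
    · refine ⟨(none, 1) :: s :: l, by simp; omega, ?_⟩
      rw [pairsProd_cons, pairsProd_cons, lampGen_one, one_mul, swapA_mul_swapA_mul]

theorem isTriangle_weight (ω : ℕ → Fin 3) (k : ℕ) : IsTriangle (weight 1 ω k) := by
  induction k with
  | zero => simp [weight, IsTriangle]
  | succ k ih => rw [weight_succ]; exact ih.weightStep _

theorem minWeight_weight_pos (ω : ℕ → Fin 3) (k : ℕ) : 0 < minWeight (weight 1 ω k) := by
  induction k with
  | zero => simp [weight, minWeight]
  | succ k ih =>
    have := two_mul_minWeight_le (isTriangle_weight ω k) (ω k)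
    rw [weight_succ]
    omega

/-- The upper bound for the growth function of `Γ_ω`. -/
theorem bOmega_le_pow (F : Type*) [Group F] [Finite F] (ω : ℕ → Fin 3) (k R r : ℕ)
    (hr : r ≤ R * minWeight (weight 1 ω k)) :
    bOmega F ω r ≤ Nat.card (Option (Option Letter × F)) ^ ((2 * R + 8) * 2 ^ k) := by
  have hpos := minWeight_weight_pos ω k
  rw [bOmega_eq_ncard]
  have h1 : permGenSet F ω ^ r ⊆ {g | ∃ M ≤ 2 ^ k * (2 * R + 6), Described F k ω M g} := by
    intro g hg
    obtain ⟨l, hl, rfl⟩ := exists_pairs_of_mem_pow ω r hg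
    obtain ⟨M, hM, hM'⟩ := exists_described (p := 1) (isTriangle_weight ω 0) k ω l
    refine ⟨M, Nat.le_of_mul_le_mul_right ?_ hpos, hM⟩
    have h2 : pairsWeight 1 l = l.length := by
      have : pairWeight (F := F) 1 = fun _ => 1 := by
        funext s
        obtain ⟨_ | v, f⟩ := s <;> simp [pairWeight, minWeight]
      simp [pairsWeight, this]
    have h3 : pairsWeight 1 l ≤ 2 * R * minWeight (weight 1 ω k) := by
      rw [h2, mul_assoc]; omega
    calc _ ≤ _ := (Nat.le_add_right _ _).trans hM'
      _ ≤ 2 ^ k * (2 * R * minWeight (weight 1 ω k) + 6 * minWeight (weight 1 ω k)) := by gcongr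
      _ = _ := by ring
  obtain ⟨h2, h3⟩ := described_finite_and_ncard_le F k ω (2 ^ k * (2 * R + 6))
  refine (Set.ncard_le_ncard h1 h2).trans (h3.trans (le_of_eq ?_))
  congr 1
  ring

/-! Sequences `ω` that make the weights grow at a prescribed speed. -/

/-- The letter `v` with `u^v(i) = id`. -/
def killed (i : Fin 3) : Letter := (![.d, .c, .b] : Fin 3 → Letter) i

/-- An invariant of the weights after a level with letter `j`. -/
def IsBalanced (j : Fin 3) (p : Letter → ℕ) : Prop :=
  p (killed j) ≤ p (killed (j + 1)) + p (killed (j + 2)) ∧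
  p (killed (j + 1)) ≤ p (killed j) + p (killed (j + 2)) ∧
  p (killed (j + 2)) ≤ p (killed j) + p (killed (j + 1)) ∧
  p (killed (j + 1)) ≤ 2 * p (killed j) ∧ p (killed (j + 2)) ≤ 2 * p (killed j) ∧
  p (killed (j + 1)) ≤ 2 * p (killed (j + 2)) ∧ p (killed (j + 2)) ≤ 3 * p (killed (j + 1))

theorem weightStep_stay (j : Fin 3) (p : Letter → ℕ) :
    weightStep j p (killed j) = p (killed j) + p (killed (j + 1)) + p (killed (j + 2)) ∧
    weightStep j p (killed (j + 1)) = 2 * p (killed (j + 1)) ∧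
    weightStep j p (killed (j + 2)) = 2 * p (killed (j + 2)) := by
  fin_cases j <;> simp [weightStep, killed, uIsA, total, Fin.add_def] <;> omega

theorem weightStep_rotate (j : Fin 3) (p : Letter → ℕ) :
    weightStep (j + 1) p (killed (j + 1)) =
      p (killed j) + p (killed (j + 1)) + p (killed (j + 2)) ∧
    weightStep (j + 1) p (killed (j + 1 + 1)) = 2 * p (killed (j + 2)) ∧
    weightStep (j + 1) p (killed (j + 1 + 2)) = 2 * p (killed j) := by
  fin_cases j <;> simp [weightStep, killed, uIsA, total, Fin.add_def] <;> omega

theorem IsBalanced.stay {j : Fin 3} {p : Letter → ℕ} (h : IsBalanced j p) :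
    IsBalanced j (weightStep j p) := by
  obtain ⟨h1, h2, h3⟩ := weightStep_stay j p
  simp only [IsBalanced, h1, h2, h3] at *
  omega

theorem IsBalanced.rotate {j : Fin 3} {p : Letter → ℕ} (h : IsBalanced j p) :
    IsBalanced (j + 1) (weightStep (j + 1) p) := by
  obtain ⟨h1, h2, h3⟩ := weightStep_rotate j p
  simp only [IsBalanced, h1, h2, h3] at *
  omega

theorem minWeight_eq_killed (j : Fin 3) (p : Letter → ℕ) :
    minWeight p = min (p (killed j)) (min (p (killed (j + 1))) (p (killed (j + 2)))) := by
  fin_cases j <;> simp [minWeight, killed, Fin.add_def] <;> omega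

/-- The linear form on weights that is multiplied by `Λ` at each change of letter. -/
def potential (Λ : ℝ) (j : Fin 3) (p : Letter → ℕ) : ℝ :=
  Λ * p (killed j) + p (killed (j + 1)) + (Λ + 2) / Λ * p (killed (j + 2))

/-- The linear form on weights that is doubled when the letter does not change. -/
def doublingForm (j : Fin 3) (p : Letter → ℕ) : ℝ := p (killed (j + 1)) + p (killed (j + 2))

theorem potential_rotate {Λ : ℝ} (h0 : 0 < Λ) (hΛ : Λ ^ 3 = Λ ^ 2 + 2 * Λ + 4) (j : Fin 3)
    (p : Letter → ℕ) :
    potential Λ (j + 1) (weightStep (j + 1) p) = Λ * potential Λ j p := by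
  obtain ⟨h1, h2, h3⟩ := weightStep_rotate j p
  simp only [potential, h1, h2, h3]
  push_cast
  field_simp
  linear_combination (-(p (killed j) : ℝ)) * hΛ

theorem doublingForm_stay (j : Fin 3) (p : Letter → ℕ) :
    doublingForm j (weightStep j p) = 2 * doublingForm j p := by
  obtain ⟨h1, h2, h3⟩ := weightStep_stay j p
  simp only [doublingForm, h2, h3]
  push_cast
  ring

theorem potential_bounds {Λ : ℝ} (h2 : 2 ≤ Λ) (h3 : Λ ≤ 3) {j : Fin 3} {p : Letter → ℕ}
    (h : IsBalanced j p) :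
    doublingForm j p ≤ potential Λ j p ∧ potential Λ j p ≤ 5 * doublingForm j p ∧
      minWeight p ≤ potential Λ j p ∧ potential Λ j p ≤ 24 * minWeight p := by
  have hq1 : 1 ≤ (Λ + 2) / Λ := by rw [le_div_iff₀ (by linarith)]; linarith
  have hq2 : (Λ + 2) / Λ ≤ 2 := by rw [div_le_iff₀ (by linarith)]; linarith
  rw [minWeight_eq_killed j]
  simp only [potential, doublingForm, IsBalanced] at *
  obtain ⟨a1, a2, a3, a4, a5, a6, a7⟩ := h
  have hmin : p (killed j) ≤ 4 * min (p (killed j)) (min (p (killed (j + 1))) (p (killed (j + 2))))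
      ∧ p (killed (j + 1)) ≤
        4 * min (p (killed j)) (min (p (killed (j + 1))) (p (killed (j + 2))))
      ∧ p (killed (j + 2)) ≤
        4 * min (p (killed j)) (min (p (killed (j + 1))) (p (killed (j + 2)))) := by omega
  have hmin' : min (p (killed j)) (min (p (killed (j + 1))) (p (killed (j + 2)))) ≤
    p (killed (j + 1)) := by omega
  generalize min (p (killed j)) (min (p (killed (j + 1))) (p (killed (j + 2)))) = m at *
  generalize p (killed j) = x at *
  generalize p (killed (j + 1)) = y at *
  generalize p (killed (j + 2)) = z at *
  obtain ⟨b1, b2, b3⟩ := hmin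
  rify at a1 a2 a3 a4 a5 a6 a7 b1 b2 b3 hmin'
  have hx : (0 : ℝ) ≤ x := Nat.cast_nonneg x
  have hy : (0 : ℝ) ≤ y := Nat.cast_nonneg y
  have hz : (0 : ℝ) ≤ z := Nat.cast_nonneg z
  have e1 : 2 * (x : ℝ) ≤ Λ * x := mul_le_mul_of_nonneg_right h2 hx
  have e2 : Λ * (x : ℝ) ≤ 3 * x := mul_le_mul_of_nonneg_right h3 hx
  have e3 : 1 * (z : ℝ) ≤ (Λ + 2) / Λ * z := mul_le_mul_of_nonneg_right hq1 hz
  have e4 : (Λ + 2) / Λ * (z : ℝ) ≤ 2 * z := mul_le_mul_of_nonneg_right hq2 hz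
  refine ⟨?_, ?_, ?_, ?_⟩ <;> linarith

theorem potential_le_stay {Λ : ℝ} (h2 : 2 ≤ Λ) (j : Fin 3) (p : Letter → ℕ) :
    potential Λ j p ≤ potential Λ j (weightStep j p) := by
  obtain ⟨h1, h3, h4⟩ := weightStep_stay j p
  simp only [potential, h1, h3, h4]
  push_cast
  have hx : (0 : ℝ) ≤ p (killed j) := Nat.cast_nonneg _
  have hy : (0 : ℝ) ≤ p (killed (j + 1)) := Nat.cast_nonneg _
  have hz : (0 : ℝ) ≤ p (killed (j + 2)) := Nat.cast_nonneg _
  have hq : 0 ≤ (Λ + 2) / Λ := by positivity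
  have e1 : 0 ≤ Λ * (p (killed (j + 1)) + p (killed (j + 2)) : ℝ) := by positivity
  have e2 : 0 ≤ (Λ + 2) / Λ * (p (killed (j + 2)) : ℝ) := by positivity
  linarith

open Classical in
/-- The greedy choice of the letters and the resulting weights: the letter is changed when the
weights are too small in comparison with the prescribed growth `g`. -/
def greedy (Λ : ℝ) (g : ℝ → ℝ) : ℕ → Fin 3 × (Letter → ℕ)
  | 0 => (0, 1)
  | k + 1 =>
    let s := greedy Λ g k
    let j := if g (Real.log (potential Λ s.1 s.2)) ≤ k * Real.log 2 then s.1 + 1 else s.1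
    (j, weightStep j s.2)

/-- The sequence of the letters of the greedy choice. -/
def greedySeq (Λ : ℝ) (g : ℝ → ℝ) (k : ℕ) : Fin 3 := (greedy Λ g (k + 1)).1

theorem weight_greedySeq (Λ : ℝ) (g : ℝ → ℝ) (k : ℕ) :
    weight 1 (greedySeq Λ g) k = (greedy Λ g k).2 := by
  induction k with
  | zero => rfl
  | succ k ih => rw [weight_succ, ih]; rfl

theorem greedy_tracks {Λ α₀ : ℝ} (h2 : 2 ≤ Λ) (h3 : Λ ≤ 3) (hΛ : Λ ^ 3 = Λ ^ 2 + 2 * Λ + 4)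
    (hα₀ : α₀ * Real.log Λ = Real.log 2) {g : ℝ → ℝ} (hg0 : g 0 = 0)
    (hg : ∀ x y, x ≤ y → α₀ * (y - x) ≤ g y - g x ∧ g y - g x ≤ y - x) (k : ℕ) :
    IsBalanced (greedy Λ g k).1 (greedy Λ g k).2 ∧
      0 < doublingForm (greedy Λ g k).1 (greedy Λ g k).2 ∧
      g (Real.log (doublingForm (greedy Λ g k).1 (greedy Λ g k).2)) ≤
        k * Real.log 2 + Real.log 3 ∧
      k * Real.log 2 - Real.log 2 ≤
        g (Real.log (potential Λ (greedy Λ g k).1 (greedy Λ g k).2)) := by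
  have hlog2 : 0 < Real.log 2 := Real.log_pos (by norm_num)
  have hlogΛ : 0 < Real.log Λ := Real.log_pos (by linarith)
  have hα : 0 < α₀ := by
    by_contra h
    nlinarith
  have hmono : ∀ x y, x ≤ y → g x ≤ g y := fun x y hxy => by
    have := (hg x y hxy).1
    have : 0 ≤ α₀ * (y - x) := mul_nonneg hα.le (by linarith)
    linarith
  induction k with
  | zero =>
    have hq : 0 ≤ (Λ + 2) / Λ := by positivity
    have h5 : doublingForm (greedy Λ g 0).1 (greedy Λ g 0).2 = 2 := by
      norm_num [greedy, doublingForm]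
    have h6 : 1 ≤ potential Λ (greedy Λ g 0).1 (greedy Λ g 0).2 := by
      simp only [greedy, potential, Pi.one_apply, Nat.cast_one, mul_one]
      linarith
    refine ⟨by simp [greedy, IsBalanced], by rw [h5]; norm_num, ?_, ?_⟩
    · have h7 := (hg 0 (Real.log 2) hlog2.le).2
      have h8 : Real.log 2 ≤ Real.log 3 := Real.log_le_log (by norm_num) (by norm_num)
      rw [h5]
      push_cast
      linarith
    · have h7 := hmono 0 _ (Real.log_nonneg h6)
      push_cast
      linarith
  | succ k ih =>
    obtain ⟨hb, hpos, ih1, ih2⟩ := ih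
    have hb' := potential_bounds h2 h3 hb
    have hNpos : 0 < potential Λ (greedy Λ g k).1 (greedy Λ g k).2 := hpos.trans_le hb'.1
    rw [greedy]
    dsimp only
    split_ifs with hc
    · have hr := hb.rotate
      have hr' := potential_bounds h2 h3 hr
      have hpot := potential_rotate (by linarith) hΛ (greedy Λ g k).1 (greedy Λ g k).2
      have hN' : 0 < potential Λ ((greedy Λ g k).1 + 1)
          (weightStep ((greedy Λ g k).1 + 1) (greedy Λ g k).2) := by
        rw [hpot]; positivity
      have hh : 0 < doublingForm ((greedy Λ g k).1 + 1)
          (weightStep ((greedy Λ g k).1 + 1) (greedy Λ g k).2) := by linarith [hr'.2.1]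
      have hlog : Real.log (potential Λ ((greedy Λ g k).1 + 1)
          (weightStep ((greedy Λ g k).1 + 1) (greedy Λ g k).2)) =
          Real.log Λ + Real.log (potential Λ (greedy Λ g k).1 (greedy Λ g k).2) := by
        rw [hpot, Real.log_mul (by linarith) hNpos.ne']
      have hstep := hg (Real.log (potential Λ (greedy Λ g k).1 (greedy Λ g k).2))
        (Real.log Λ + Real.log (potential Λ (greedy Λ g k).1 (greedy Λ g k).2)) (by linarith)
      rw [add_sub_cancel_right, hα₀] at hstep
      refine ⟨hr, hh, ?_, ?_⟩
      · have h7 := hmono _ _ (Real.log_le_log hh hr'.1)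
        rw [hlog] at h7
        have h8 : Real.log Λ ≤ Real.log 3 := Real.log_le_log (by linarith) h3
        push_cast
        linarith [hstep.2]
      · rw [hlog]
        push_cast
        linarith [hstep.1]
    · have hd := doublingForm_stay (greedy Λ g k).1 (greedy Λ g k).2
      refine ⟨hb.stay, by rw [hd]; positivity, ?_, ?_⟩
      · rw [hd, Real.log_mul (by norm_num) hpos.ne']
        have h7 := (hg (Real.log (doublingForm (greedy Λ g k).1 (greedy Λ g k).2))
          (Real.log 2 + Real.log (doublingForm (greedy Λ g k).1 (greedy Λ g k).2))
          (by linarith)).2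
        push_cast
        linarith
      · have h7 := hmono _ _ (Real.log_le_log hNpos
          (potential_le_stay h2 (greedy Λ g k).1 (greedy Λ g k).2))
        push_cast
        linarith

theorem minWeight_greedySeq {Λ α₀ : ℝ} (h2 : 2 ≤ Λ) (h3 : Λ ≤ 3)
    (hΛ : Λ ^ 3 = Λ ^ 2 + 2 * Λ + 4) (hα₀ : α₀ * Real.log Λ = Real.log 2) {g : ℝ → ℝ}
    (hg0 : g 0 = 0) (hg : ∀ x y, x ≤ y → α₀ * (y - x) ≤ g y - g x ∧ g y - g x ≤ y - x)
    (hmono : Monotone g) (k : ℕ) :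
    |g (Real.log (minWeight (weight 1 (greedySeq Λ g) k))) - k * Real.log 2| ≤ Real.log 48 := by
  obtain ⟨hb, hpos, h4, h5⟩ := greedy_tracks h2 h3 hΛ hα₀ hg0 hg k
  have hm : 0 < (minWeight (greedy Λ g k).2 : ℝ) := by
    rw [← weight_greedySeq]
    exact_mod_cast minWeight_weight_pos _ k
  obtain ⟨b1, b2, b3, b4⟩ := potential_bounds h2 h3 hb
  rw [weight_greedySeq]
  have hN : 0 < potential Λ (greedy Λ g k).1 (greedy Λ g k).2 := hpos.trans_le b1
  have e1 : Real.log (minWeight (greedy Λ g k).2) ≤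
      Real.log 5 + Real.log (doublingForm (greedy Λ g k).1 (greedy Λ g k).2) := by
    rw [← Real.log_mul (by norm_num) hpos.ne']
    exact Real.log_le_log hm (b3.trans b2)
  have e2 : Real.log (potential Λ (greedy Λ g k).1 (greedy Λ g k).2) ≤
      Real.log 24 + Real.log (minWeight (greedy Λ g k).2) := by
    rw [← Real.log_mul (by norm_num) hm.ne']
    exact Real.log_le_log hN b4
  have l5 : 0 < Real.log 5 := Real.log_pos (by norm_num)
  have l24 : 0 < Real.log 24 := Real.log_pos (by norm_num)
  have l48 : Real.log 48 = Real.log 24 + Real.log 2 := by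
    rw [← Real.log_mul (by norm_num) (by norm_num)]; norm_num
  have l15 : Real.log 5 + Real.log 3 ≤ Real.log 48 := by
    rw [← Real.log_mul (by norm_num) (by norm_num)]
    exact Real.log_le_log (by norm_num) (by norm_num)
  have f1 := hmono e1
  have f2 := hmono e2
  have f3 := (hg (Real.log (doublingForm (greedy Λ g k).1 (greedy Λ g k).2)) _
    (le_add_of_nonneg_left l5.le)).2
  have f4 := (hg (Real.log (minWeight (greedy Λ g k).2)) _ (le_add_of_nonneg_left l24.le)).2
  rw [abs_le]
  constructor <;> linarith

theorem eta_bounds {η : ℝ} (hη : η ^ 3 + η ^ 2 + η - 2 = 0) : 2 / 3 < η ∧ η < 1 := by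
  constructor
  · by_contra h
    push Not at h
    nlinarith [mul_nonneg (sub_nonneg.2 h) (add_nonneg (sq_nonneg (η + 5 / 6))
      (show (0 : ℝ) ≤ 17 / 12 by norm_num))]
  · by_contra h
    push Not at h
    nlinarith [pow_le_pow_left₀ (zero_le_one' ℝ) h 2, pow_le_pow_left₀ (zero_le_one' ℝ) h 3]

/-- For every function `g` with slopes between `α₀` and `1` there is a group `Γ_ω` whose growth
function `b` satisfies `log log b(r) = g(log r) + O(1)`. -/
theorem exists_growth (F : Type*) [Group F] [Finite F] [Nontrivial F] {η α₀ : ℝ}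
    (hη : η ^ 3 + η ^ 2 + η - 2 = 0) (hα₀ : α₀ = Real.log 2 / (Real.log 2 - Real.log η)) :
    ∃ C : ℝ, ∀ g : ℝ → ℝ, g 0 = 0 →
      (∀ x y, x ≤ y → α₀ * (y - x) ≤ g y - g x ∧ g y - g x ≤ y - x) →
      ∃ ω : ℕ → Fin 3, ∀ r : ℕ, 2 ≤ r →
        |Real.log (Real.log (bOmega F ω r)) - g (Real.log r)| ≤ C := by
  obtain ⟨hη1, hη2⟩ := eta_bounds hη
  have hη0 : 0 < η := by linarith
  set Λ := 2 / η with hΛdef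
  have h2 : 2 ≤ Λ := by rw [hΛdef, le_div_iff₀ hη0]; linarith
  have h3 : Λ ≤ 3 := by rw [hΛdef, div_le_iff₀ hη0]; linarith
  have hΛ : Λ ^ 3 = Λ ^ 2 + 2 * Λ + 4 := by
    rw [hΛdef]
    field_simp
    linear_combination (-4) * hη
  have hlogΛ : Real.log 2 - Real.log η = Real.log Λ := by
    rw [hΛdef, Real.log_div (by norm_num) hη0.ne']
  have hlog2 : 0 < Real.log 2 := Real.log_pos (by norm_num)
  have hlogΛpos : 0 < Real.log Λ := Real.log_pos (by linarith)
  rw [hlogΛ] at hα₀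
  have hα : α₀ * Real.log Λ = Real.log 2 := by rw [hα₀]; field_simp
  have hαpos : 0 < α₀ := by rw [hα₀]; positivity
  have hF : 1 < Nat.card F := Finite.one_lt_card
  set A := Nat.card (Option (Option Letter × F)) with hA
  have hA1 : 1 < A := by
    rw [hA]
    exact Finite.one_lt_card
  have hlogF : 0 < Real.log (Nat.card F) := Real.log_pos (by exact_mod_cast hF)
  have hlogA : 0 < Real.log A := Real.log_pos (by exact_mod_cast hA1)
  refine ⟨2 * Real.log 2 + Real.log 48 + |Real.log (Real.log (Nat.card F))| +
    |Real.log (12 * Real.log A)|, fun g hg0 hg => ?_⟩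
  have hmono : Monotone g := fun x y hxy => by
    have := (hg x y hxy).1
    have : 0 ≤ α₀ * (y - x) := mul_nonneg hαpos.le (by linarith)
    linarith
  refine ⟨greedySeq Λ g, fun r hr => ?_⟩
  set m : ℕ → ℕ := fun k => minWeight (weight 1 (greedySeq Λ g) k) with hm
  have hmpos : ∀ k, 0 < m k := minWeight_weight_pos _
  have hm2 : ∀ k, k < m k := fun k => by
    induction k with
    | zero => exact hmpos 0
    | succ k ih =>
      have := two_mul_minWeight_le (isTriangle_weight (greedySeq Λ g) k) (greedySeq Λ g k)
      rw [← weight_succ] at this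
      simp only [hm] at *
      omega
  have htr : ∀ k : ℕ, |g (Real.log (m k)) - k * Real.log 2| ≤ Real.log 48 :=
    minWeight_greedySeq h2 h3 hΛ hα hg0 hg hmono
  have hex : ∃ k, r < 2 * m k := ⟨r, by have := hm2 r; omega⟩
  obtain ⟨k, hk1, hk2⟩ : ∃ k, 2 * m k ≤ r ∧ r < 2 * m (k + 1) := by
    classical
    have h0 : m 0 = 1 := by simp [hm, weight, minWeight]
    have hne : Nat.find hex ≠ 0 := fun h => by
      have := Nat.find_spec hex
      rw [h, h0] at this
      omega
    obtain ⟨k, hk⟩ := Nat.exists_eq_succ_of_ne_zero hne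
    refine ⟨k, not_lt.1 (Nat.find_min hex (by omega)), ?_⟩
    have := Nat.find_spec hex
    rwa [hk] at this
  have hmk : (0 : ℝ) < m k := by exact_mod_cast hmpos k
  have hmk' : (0 : ℝ) < m (k + 1) := by exact_mod_cast hmpos (k + 1)
  have hr0 : (0 : ℝ) < r := by exact_mod_cast (by omega : 0 < r)
  have hlow : Nat.card F ^ 2 ^ k ≤ bOmega F (greedySeq Λ g) r := by
    obtain ⟨v, hv⟩ : ∃ v, weight 1 (greedySeq Λ g) k v = m k := by
      simp only [hm, minWeight]
      rcases min_choice (weight 1 (greedySeq Λ g) k .b)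
        (min (weight 1 (greedySeq Λ g) k .c) (weight 1 (greedySeq Λ g) k .d)) with h | h
      · exact ⟨.b, h.symm⟩
      · rcases min_choice (weight 1 (greedySeq Λ g) k .c) (weight 1 (greedySeq Λ g) k .d)
          with h' | h'
        · exact ⟨.c, by rw [h, h']⟩
        · exact ⟨.d, by rw [h, h']⟩
    refine (card_pow_le_bOmega F _ k v).trans (bOmega_mono F _ ?_)
    rw [hv]; exact hk1
  have hup := bOmega_le_pow F (greedySeq Λ g) (k + 1) 2 r hk2.le
  have hb0 : 0 < bOmega F (greedySeq Λ g) r := lt_of_lt_of_le (by positivity) hlow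
  have hL1 : 2 ^ k * Real.log (Nat.card F) ≤ Real.log (bOmega F (greedySeq Λ g) r) := by
    have : Real.log ((Nat.card F : ℝ) ^ 2 ^ k) ≤ Real.log (bOmega F (greedySeq Λ g) r) :=
      Real.log_le_log (by positivity) (by exact_mod_cast hlow)
    rwa [Real.log_pow, Nat.cast_pow, Nat.cast_ofNat] at this
  have hL2 : Real.log (bOmega F (greedySeq Λ g) r) ≤ 2 ^ (k + 1) * (12 * Real.log A) := by
    have : Real.log (bOmega F (greedySeq Λ g) r) ≤ Real.log ((A : ℝ) ^ (12 * 2 ^ (k + 1))) :=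
      Real.log_le_log (by exact_mod_cast hb0) (by exact_mod_cast hup)
    rw [Real.log_pow] at this
    push_cast at this
    linarith
  have hpos1 : 0 < 2 ^ k * Real.log (Nat.card F) := by positivity
  have hLL1 := Real.log_le_log hpos1 hL1
  have hLL2 := Real.log_le_log (hpos1.trans_le hL1) hL2
  rw [Real.log_mul (by positivity) hlogF.ne', Real.log_pow] at hLL1
  rw [Real.log_mul (by positivity) (by positivity), Real.log_pow] at hLL2
  push_cast at hLL2
  have hg1 := hmono (Real.log_le_log hmk (by
    exact_mod_cast (by omega : m k ≤ r) : (m k : ℝ) ≤ r))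
  have hg2 := hmono (Real.log_le_log hr0 (by exact_mod_cast hk2.le : (r : ℝ) ≤ 2 * m (k + 1)))
  rw [Real.log_mul (by norm_num) hmk'.ne'] at hg2
  have hg3 := (hg (Real.log (m (k + 1))) (Real.log 2 + Real.log (m (k + 1))) (by linarith)).2
  have ht1 := abs_le.1 (htr k)
  have ht2 := abs_le.1 (htr (k + 1))
  push_cast at ht2
  have ha1 := neg_abs_le (Real.log (Real.log (Nat.card F)))
  have ha2 := le_abs_self (Real.log (12 * Real.log A))
  have ha3 := abs_nonneg (Real.log (Real.log (Nat.card F)))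
  have ha4 := abs_nonneg (Real.log (12 * Real.log A))
  rw [abs_le]
  constructor <;> linarith [ht1.1, ht2.2]

/-! Oscillating growth. -/

/-- The number `i` with `i! ≤ n < (i + 1)!`. -/
def phase (n : ℕ) : ℕ := Nat.findGreatest (fun i => i.factorial ≤ n) n

theorem phase_eq {i n : ℕ} (h1 : i.factorial ≤ n) (h2 : n < (i + 1).factorial) : phase n = i := by
  rw [phase, Nat.findGreatest_eq_iff]
  refine ⟨(Nat.self_le_factorial i).trans h1, fun _ => h1, fun j hj _ h => ?_⟩
  exact absurd (h2.trans_le (Nat.factorial_le (Nat.succ_le_of_lt hj))) (not_lt.2 h)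

/-- The logarithm of the beginning of a phase. -/
def phaseStart (i : ℕ) : ℝ := i.factorial * Real.log 2

theorem phaseStart_pos (i : ℕ) : 0 < phaseStart i :=
  mul_pos (by exact_mod_cast Nat.factorial_pos i) (Real.log_pos (by norm_num))

theorem phaseStart_succ (i : ℕ) : phaseStart (i + 1) = (i + 1) * phaseStart i := by
  rw [phaseStart, Nat.factorial_succ, phaseStart]
  push_cast
  ring

theorem exists_oscillating {α β : ℝ} (hα : 0 ≤ α) (hβ : β ≤ 1) (σ : ℕ → ℝ)
    (hσ : ∀ i, α ≤ σ i ∧ σ i ≤ β) :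
    ∃ g : ℝ → ℝ, g 0 = 0 ∧
      (∀ x y, x ≤ y → α * (y - x) ≤ g y - g x ∧ g y - g x ≤ β * (y - x)) ∧
      ∀ i, |g (phaseStart (i + 1)) - σ i * phaseStart (i + 1)| ≤ phaseStart i := by
  have hlog2 : 0 < Real.log 2 := Real.log_pos (by norm_num)
  set s : ℝ → ℝ := fun t => σ (phase ⌊t / Real.log 2⌋₊) with hs
  have hmeas : Measurable s :=
    (measurable_of_countable (fun n : ℕ => σ (phase n))).comp
      (Nat.measurable_floor.comp (measurable_id.div_const _))
  have hint : ∀ x y : ℝ, IntervalIntegrable s MeasureTheory.volume x y := fun x y => by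
    refine (intervalIntegrable_const (c := (1 : ℝ))).mono_fun hmeas.aestronglyMeasurable
      (Eventually.of_forall fun t => ?_)
    have := hσ (phase ⌊t / Real.log 2⌋₊)
    simp only [Real.norm_eq_abs, abs_one, abs_le, hs]
    constructor <;> linarith
  have hbound : ∀ c c' x y : ℝ, x ≤ y → (∀ t ∈ Set.Ioo x y, c ≤ s t ∧ s t ≤ c') →
      c * (y - x) ≤ (∫ t in (0 : ℝ)..y, s t) - (∫ t in (0 : ℝ)..x, s t) ∧
      (∫ t in (0 : ℝ)..y, s t) - (∫ t in (0 : ℝ)..x, s t) ≤ c' * (y - x) := by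
    intro c c' x y hxy h
    rw [intervalIntegral.integral_interval_sub_left (hint 0 y) (hint 0 x)]
    have h1 := intervalIntegral.integral_mono_on_of_le_Ioo hxy
      (intervalIntegrable_const (c := c)) (hint x y) fun t ht => (h t ht).1
    have h2 := intervalIntegral.integral_mono_on_of_le_Ioo hxy (hint x y)
      (intervalIntegrable_const (c := c')) fun t ht => (h t ht).2
    rw [intervalIntegral.integral_const, smul_eq_mul] at h1 h2
    constructor <;> linarith
  refine ⟨fun x => ∫ t in (0 : ℝ)..x, s t, by simp, fun x y hxy =>
    hbound α β x y hxy fun t _ => hσ _, fun i => ?_⟩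
  have hT := phaseStart_pos i
  have hle : phaseStart i ≤ phaseStart (i + 1) := by
    rw [phaseStart_succ]
    nlinarith [(Nat.cast_nonneg i : (0 : ℝ) ≤ i)]
  have h1 := hbound (σ i) (σ i) _ _ hle fun t ht => by
    have : s t = σ i := by
      rw [hs]
      dsimp only
      rw [phase_eq (i := i)]
      · rw [Nat.le_floor_iff' (Nat.factorial_ne_zero i), le_div_iff₀ hlog2]
        exact ht.1.le
      · rw [Nat.floor_lt' (Nat.factorial_ne_zero _), div_lt_iff₀ hlog2]
        exact ht.2
    rw [this]
    exact ⟨le_rfl, le_rfl⟩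
  have h2 := hbound 0 1 0 (phaseStart i) hT.le fun t _ => by
    have := hσ (phase ⌊t / Real.log 2⌋₊)
    constructor <;> linarith
  rw [intervalIntegral.integral_same] at h2
  have h3 := hσ i
  have h4 : 0 ≤ σ i * phaseStart i := mul_nonneg (by linarith) hT.le
  have h5 : σ i * phaseStart i ≤ phaseStart i := by nlinarith
  rw [abs_le]
  constructor <;> linarith [h1.1, h1.2, h2.1, h2.2]

theorem liminf_eq_of_subseq {x : ℕ → ℝ} {e : ℕ → ℝ} {c : ℝ} (he : Tendsto e atTop (𝓝 0))
    (h : ∀ᶠ r in atTop, c - e r ≤ x r) {φ : ℕ → ℕ} (hφ : Tendsto φ atTop atTop)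
    (hx : Tendsto (fun j => x (φ j)) atTop (𝓝 c)) :
    liminf (fun r => (x r : EReal)) atTop = (c : EReal) := by
  refine le_antisymm ?_ ?_
  · have h1 : Tendsto (fun j => (x (φ j) : EReal)) atTop (𝓝 (c : EReal)) :=
      (continuous_coe_real_ereal.tendsto c).comp hx
    rw [← h1.liminf_eq]
    exact liminf_le_liminf_of_le hφ
  · have h1 : Tendsto (fun r => ((c - e r : ℝ) : EReal)) atTop (𝓝 (c : EReal)) := by
      refine (continuous_coe_real_ereal.tendsto c).comp ?_
      simpa using tendsto_const_nhds.sub he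
    rw [← h1.liminf_eq]
    exact liminf_le_liminf (h.mono fun r hr => EReal.coe_le_coe_iff.2 hr)

theorem limsup_eq_of_subseq {x : ℕ → ℝ} {e : ℕ → ℝ} {c : ℝ} (he : Tendsto e atTop (𝓝 0))
    (h : ∀ᶠ r in atTop, x r ≤ c + e r) {φ : ℕ → ℕ} (hφ : Tendsto φ atTop atTop)
    (hx : Tendsto (fun j => x (φ j)) atTop (𝓝 c)) :
    limsup (fun r => (x r : EReal)) atTop = (c : EReal) := by
  refine le_antisymm ?_ ?_
  · have h1 : Tendsto (fun r => ((c + e r : ℝ) : EReal)) atTop (𝓝 (c : EReal)) := by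
      refine (continuous_coe_real_ereal.tendsto c).comp ?_
      simpa using tendsto_const_nhds.add he
    rw [← h1.limsup_eq]
    exact limsup_le_limsup (h.mono fun r hr => EReal.coe_le_coe_iff.2 hr)
  · have h1 : Tendsto (fun j => (x (φ j) : EReal)) atTop (𝓝 (c : EReal)) :=
      (continuous_coe_real_ereal.tendsto c).comp hx
    rw [← h1.limsup_eq]
    have h2 : limsup (fun r => (x r : EReal)) (map φ atTop) ≤
      limsup (fun r => (x r : EReal)) atTop := limsup_le_limsup_of_le hφ
    exact h2

/-- `Γ_{om f}` has exponents `α` and `β`, and its growth function is close to `exp(r^{f i})` at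
`r = r i`. -/
def IsOscillatingFamily (F : Type*) [Group F] (α β : ℝ)
    (om : (ℕ → ({α, β} : Set ℝ)) → (ℕ → Fin 3)) (r : ℕ → ℕ) (ε : ℕ → ℝ) : Prop :=
  (∀ i, 2 ≤ r i) ∧ Tendsto r atTop atTop ∧
  (∀ i, 0 < ε i ∧ ε i < (β - α) / 2) ∧ Tendsto ε atTop (𝓝 0) ∧
  ∀ f : ℕ → ({α, β} : Set ℝ),
    (lowerExponent (bOmega F (om f)) = (α : EReal) ∧
      upperExponent (bOmega F (om f)) = (β : EReal)) ∧
    (∀ i, (f i : ℝ) = β → β - ε i ≤ logLogRatio (bOmega F (om f)) (r i)) ∧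
    (∀ i, (f i : ℝ) = α → logLogRatio (bOmega F (om f)) (r i) ≤ α + ε i)

theorem alpha_zero_pos {η α₀ : ℝ} (hη : η ^ 3 + η ^ 2 + η - 2 = 0)
    (hα₀ : α₀ = Real.log 2 / (Real.log 2 - Real.log η)) : 0 < α₀ := by
  obtain ⟨h1, h2⟩ := eta_bounds hη
  have h3 : 0 < Real.log 2 := Real.log_pos (by norm_num)
  have h4 : Real.log η < 0 := Real.log_neg (by linarith) h2
  rw [hα₀]
  exact div_pos h3 (by linarith)

/-- The exponents of the successive phases. -/
def phaseExponent {α β : ℝ} (I : ℕ) (f : ℕ → ({α, β} : Set ℝ)) (i : ℕ) : ℝ :=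
  if i % 3 = 0 then f (i / 3 - I) else if i % 3 = 1 then α else β

theorem phaseExponent_zero {α β : ℝ} (I : ℕ) (f : ℕ → ({α, β} : Set ℝ)) (j : ℕ) :
    phaseExponent I f (3 * (j + I)) = f j := by
  have h2 : 3 * (j + I) / 3 - I = j := by omega
  rw [phaseExponent, if_pos (by omega), h2]

theorem phaseExponent_one {α β : ℝ} (I : ℕ) (f : ℕ → ({α, β} : Set ℝ)) (j : ℕ) :
    phaseExponent I f (3 * j + 1) = α := by
  rw [phaseExponent, if_neg (by omega), if_pos (by omega)]

theorem phaseExponent_two {α β : ℝ} (I : ℕ) (f : ℕ → ({α, β} : Set ℝ)) (j : ℕ) :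
    phaseExponent I f (3 * j + 2) = β := by
  rw [phaseExponent, if_neg (by omega), if_neg (by omega)]

theorem phaseExponent_mem {α β : ℝ} (hαβ : α < β) (I : ℕ) (f : ℕ → ({α, β} : Set ℝ)) (i : ℕ) :
    α ≤ phaseExponent I f i ∧ phaseExponent I f i ≤ β := by
  have h : (f (i / 3 - I) : ℝ) = α ∨ (f (i / 3 - I) : ℝ) = β := (f (i / 3 - I)).2
  unfold phaseExponent
  split_ifs
  · rcases h with h | h <;> rw [h] <;> constructor <;> linarith
  · constructor <;> linarith
  · constructor <;> linarith

theorem exists_isOscillatingFamily (F : Type*) [Group F] [Finite F] [Nontrivial F] {η α₀ : ℝ}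
    (hη : η ^ 3 + η ^ 2 + η - 2 = 0) (hα₀ : α₀ = Real.log 2 / (Real.log 2 - Real.log η)) :
    ∃ C : ℝ, ∀ α β : ℝ, α₀ ≤ α → α < β → β ≤ 1 → ∃ om r ε,
      IsOscillatingFamily F α β om r ε ∧
        ∀ f, ∀ n : ℕ, 2 ≤ n →
          Real.log (Real.log (bOmega F (om f) n)) ≤ β * Real.log n + C := by
  obtain ⟨C₁, hC₁⟩ := exists_growth F hη hα₀
  have hα₀pos := alpha_zero_pos hη hα₀
  have hlog2 : 0 < Real.log 2 := Real.log_pos (by norm_num)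
  set C := |C₁| with hCdef
  have hC0 : 0 ≤ C := abs_nonneg _
  refine ⟨C, fun α β hα hαβ hβ => ?_⟩
  have hα0 : 0 ≤ α := by linarith
  set K := 1 + C / Real.log 2 with hK
  have hKpos : 0 < K := by positivity
  obtain ⟨I, hI⟩ := exists_nat_gt (2 * K / (β - α))
  choose g hg0 hg hgT using fun f : ℕ → ({α, β} : Set ℝ) =>
    exists_oscillating hα0 hβ (phaseExponent I f) (phaseExponent_mem hαβ I f)
  choose om hom using fun f => hC₁ (g f) (hg0 f) fun x y hxy =>
    ⟨(mul_le_mul_of_nonneg_right hα (sub_nonneg.2 hxy)).trans (hg f x y hxy).1,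
      (hg f x y hxy).2.trans (mul_le_of_le_one_left (sub_nonneg.2 hxy) hβ)⟩
  have hom' : ∀ f, ∀ r : ℕ, 2 ≤ r →
      |Real.log (Real.log (bOmega F (om f) r)) - g f (Real.log r)| ≤ C := fun f r hr =>
    (hom f r hr).trans (le_abs_self _)
  have hlogpos : ∀ r : ℕ, 2 ≤ r → 0 < Real.log r := fun r hr =>
    Real.log_pos (by exact_mod_cast (by omega : 1 < r))
  have hlow : ∀ f, ∀ r : ℕ, 2 ≤ r →
      α * Real.log r - C ≤ Real.log (Real.log (bOmega F (om f) r)) := fun f r hr => by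
    have h1 := (hg f 0 _ (hlogpos r hr).le).1
    rw [hg0, sub_zero, sub_zero] at h1
    linarith [(abs_le.1 (hom' f r hr)).1]
  have hup : ∀ f, ∀ r : ℕ, 2 ≤ r →
      Real.log (Real.log (bOmega F (om f) r)) ≤ β * Real.log r + C := fun f r hr => by
    have h1 := (hg f 0 _ (hlogpos r hr).le).2
    rw [hg0, sub_zero, sub_zero] at h1
    linarith [(abs_le.1 (hom' f r hr)).2]
  set R : ℕ → ℕ := fun i => 2 ^ (i + 1).factorial with hR
  have hR2 : ∀ i, 2 ≤ R i := fun i => by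
    calc 2 = 2 ^ 1 := rfl
      _ ≤ _ := Nat.pow_le_pow_right (by norm_num) (Nat.factorial_pos _)
  have hRtop : Tendsto R atTop atTop :=
    tendsto_atTop_mono (fun i => (by
      have h1 := Nat.self_le_factorial (i + 1)
      have h2 := (Nat.lt_two_pow_self (n := (i + 1).factorial))
      simp only [hR]; omega : i ≤ R i)) tendsto_id
  have hratio : ∀ f i, |logLogRatio (bOmega F (om f)) (R i) - phaseExponent I f i| ≤
      K / (i + 1) := by
    intro f i
    have hlogR : Real.log (R i) = phaseStart (i + 1) := by
      simp only [hR, phaseStart]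
      push_cast
      rw [Real.log_pow]
    have h1 := abs_le.1 (hom' f (R i) (hR2 i))
    have h2 := abs_le.1 (hgT f i)
    have hT := phaseStart_pos i
    have hT' := phaseStart_pos (i + 1)
    have hi : (0 : ℝ) < i + 1 := by positivity
    have hCT : C ≤ C / Real.log 2 * phaseStart i := by
      rw [phaseStart, mul_comm (i.factorial : ℝ), ← mul_assoc, div_mul_cancel₀ _ hlog2.ne']
      exact le_mul_of_one_le_right hC0 (by exact_mod_cast Nat.factorial_pos i)
    have hKT : K / (i + 1) * phaseStart (i + 1) = phaseStart i + C / Real.log 2 * phaseStart i := by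
      rw [phaseStart_succ, hK]
      field_simp
    rw [hlogR] at h1
    rw [logLogRatio, hlogR, div_sub' hT'.ne', abs_div, abs_of_pos hT', div_le_iff₀ hT', hKT,
      abs_le]
    constructor <;> nlinarith
  have hKlim : Tendsto (fun i : ℕ => K / ((i : ℝ) + 1)) atTop (𝓝 0) :=
    tendsto_const_div_atTop_nhds_zero_nat K |>.comp (tendsto_add_atTop_nat 1) |>.congr fun i => by
      simp
  have hClim : Tendsto (fun r : ℕ => C / Real.log r) atTop (𝓝 0) :=
    (Real.tendsto_log_atTop.comp tendsto_natCast_atTop_atTop).const_div_atTop C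
  have hsub : ∀ (f : ℕ → ({α, β} : Set ℝ)) (φ : ℕ → ℕ) (c : ℝ), Tendsto φ atTop atTop →
      (∀ j, phaseExponent I f (φ j) = c) →
      Tendsto (fun j => logLogRatio (bOmega F (om f)) (R (φ j))) atTop (𝓝 c) := by
    intro f φ c hφ hc
    rw [tendsto_iff_norm_sub_tendsto_zero]
    refine squeeze_zero (fun _ => norm_nonneg _) (fun j => ?_) (hKlim.comp hφ)
    rw [← hc j]
    exact hratio f (φ j)
  have h3top : ∀ m : ℕ, Tendsto (fun j => 3 * j + m) atTop atTop := fun m =>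
    tendsto_atTop_mono (fun j => by omega : ∀ j, j ≤ 3 * j + m) tendsto_id
  have h3top' : Tendsto (fun j => 3 * (j + I)) atTop atTop :=
    tendsto_atTop_mono (fun j => by omega : ∀ j, j ≤ 3 * (j + I)) tendsto_id
  refine ⟨om, fun i => R (3 * (i + I)), fun i => K / ((3 * (i + I) : ℕ) + 1),
    ⟨fun i => hR2 _, hRtop.comp h3top', fun i => ⟨by positivity, ?_⟩, hKlim.comp h3top',
      fun f => ⟨⟨?_, ?_⟩, fun i hi => ?_, fun i hi => ?_⟩⟩, hup⟩
  · rw [div_lt_iff₀ (sub_pos.2 hαβ)] at hI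
    rw [div_lt_iff₀ (by positivity)]
    push_cast
    have : (0 : ℝ) ≤ i := Nat.cast_nonneg i
    have : (0 : ℝ) ≤ I := Nat.cast_nonneg I
    nlinarith [mul_nonneg (sub_pos.2 hαβ).le ‹(0 : ℝ) ≤ i›, mul_nonneg (sub_pos.2 hαβ).le ‹(0 : ℝ) ≤ I›]
  · refine liminf_eq_of_subseq hClim ?_ (hRtop.comp (h3top 1))
      (hsub f _ α (h3top 1) (phaseExponent_one I f))
    filter_upwards [eventually_ge_atTop 2] with r hr
    rw [logLogRatio, le_div_iff₀ (hlogpos r hr), sub_mul, div_mul_cancel₀ _ (hlogpos r hr).ne']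
    exact hlow f r hr
  · refine limsup_eq_of_subseq hClim ?_ (hRtop.comp (h3top 2))
      (hsub f _ β (h3top 2) (phaseExponent_two I f))
    filter_upwards [eventually_ge_atTop 2] with r hr
    rw [logLogRatio, div_le_iff₀ (hlogpos r hr), add_mul, div_mul_cancel₀ _ (hlogpos r hr).ne']
    exact hup f r hr
  · have := abs_le.1 (hratio f (3 * (i + I)))
    rw [phaseExponent_zero, hi] at this
    linarith [this.1]
  · have := abs_le.1 (hratio f (3 * (i + I)))
    rw [phaseExponent_zero, hi] at this
    linarith [this.2]

theorem bOmega_mul_le (F : Type*) [Group F] (ω : ℕ → Fin 3) (c r : ℕ) :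
    bOmega F ω (c * r) ≤ bOmega F ω r ^ c := by
  rw [bOmega, growth, growth, mul_comm, pow_mul]
  generalize genSet F ω ^ r = S
  induction c with
  | zero => rw [pow_zero, pow_zero, ← Set.singleton_one, Set.ncard_singleton]
  | succ c ih =>
    rw [pow_succ, pow_succ]
    have h := Set.natCard_mul_le (s := S ^ c) (t := S)
    rw [Nat.card_coe_set_eq, Nat.card_coe_set_eq, Nat.card_coe_set_eq] at h
    exact h.trans (Nat.mul_le_mul_right _ ih)

theorem one_lt_bOmega (F : Type*) [Group F] [Finite F] [Nontrivial F] (ω : ℕ → Fin 3) {r : ℕ}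
    (hr : 2 ≤ r) : 1 < bOmega F ω r := by
  have h := card_pow_le_bOmega F ω 0 .b
  have h1 : (1 : ℕ) < Nat.card F := Finite.one_lt_card
  simp only [pow_zero, pow_one, weight, Pi.one_apply, mul_one] at h
  exact (h1.trans_le h).trans_le (bOmega_mono F ω hr)

theorem not_growthLE {F : Type*} [Group F] [Finite F] [Nontrivial F] {α β : ℝ} (hαβ : α < β)
    {om : (ℕ → ({α, β} : Set ℝ)) → (ℕ → Fin 3)} {r : ℕ → ℕ} {ε : ℕ → ℝ}
    (h : IsOscillatingFamily F α β om r ε) {f f' : ℕ → ({α, β} : Set ℝ)}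
    (hf : ∃ᶠ i in atTop, (f i : ℝ) = β ∧ (f' i : ℝ) = α) :
    ¬ GrowthLE (bOmega F (om f)) (bOmega F (om f')) := by
  rintro ⟨c, hc⟩
  obtain ⟨hr2, hr, -, hε, H⟩ := h
  have hlog : Tendsto (fun i => Real.log (r i)) atTop atTop :=
    Real.tendsto_log_atTop.comp (tendsto_natCast_atTop_atTop.comp hr)
  have hev1 : ∀ᶠ i in atTop, ε i < (β - α) / 4 := hε.eventually_lt_const (by linarith)
  have hev2 : ∀ᶠ i in atTop, Real.log (c + 1 : ℕ) / ((β - α) / 2) < Real.log (r i) :=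
    hlog.eventually_gt_atTop _
  obtain ⟨i, ⟨h1, h2⟩, h3, h4⟩ := (hf.and_eventually (hev1.and hev2)).exists
  have hL : 0 < Real.log (r i) := Real.log_pos (by exact_mod_cast (hr2 i))
  have e1 := (H f).2.1 i h1
  have e2 := (H f').2.2 i h2
  rw [logLogRatio, le_div_iff₀ hL] at e1
  rw [logLogRatio, div_le_iff₀ hL] at e2
  have hb : bOmega F (om f) (r i) ≤ bOmega F (om f') (r i) ^ (c + 1) :=
    (hc (r i)).trans ((bOmega_mono F _ (Nat.mul_le_mul_right _ (Nat.le_succ c))).trans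
      (bOmega_mul_le F _ _ _))
  have hpos : 0 < Real.log (bOmega F (om f) (r i)) :=
    Real.log_pos (by exact_mod_cast one_lt_bOmega F _ (hr2 i))
  have hpos' : 0 < Real.log (bOmega F (om f') (r i)) :=
    Real.log_pos (by exact_mod_cast one_lt_bOmega F _ (hr2 i))
  have hlogb : Real.log (bOmega F (om f) (r i)) ≤
      (c + 1 : ℕ) * Real.log (bOmega F (om f') (r i)) := by
    rw [← Real.log_pow]
    refine Real.log_le_log ?_ (by exact_mod_cast hb)
    exact_mod_cast (zero_lt_one.trans (one_lt_bOmega F _ (hr2 i)))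
  have hll := Real.log_le_log hpos hlogb
  rw [Real.log_mul (by positivity) hpos'.ne'] at hll
  rw [div_lt_iff₀ (by linarith)] at h4
  nlinarith

/-- A function that determines `x` by each of its tails. -/
def spread (α β : ℝ) (x : ℕ → Bool) (i : ℕ) : ({α, β} : Set ℝ) :=
  if x ((Nat.unpair i).2 / 2) = decide ((Nat.unpair i).2 % 2 = 0) then ⟨β, by simp⟩
    else ⟨α, by simp⟩

theorem frequently_spread (α β : ℝ) {x y : ℕ → Bool} (h : x ≠ y) :
    ∃ᶠ i in atTop, (spread α β x i : ℝ) = β ∧ (spread α β y i : ℝ) = α := by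
  obtain ⟨j, hj⟩ := Function.ne_iff.1 h
  rw [frequently_atTop]
  intro m
  cases hx : x j
  · have hy : y j = true := by
      rw [hx] at hj
      exact Bool.eq_true_of_not_eq_false fun h => hj h.symm
    have h1 : (2 * j + 1) / 2 = j := by omega
    refine ⟨Nat.pair m (2 * j + 1), Nat.left_le_pair _ _, ?_⟩
    simp [spread, h1, hx, hy]
  · have hy : y j = false := by
      rw [hx] at hj
      exact Bool.eq_false_of_not_eq_true fun h => hj h.symm
    refine ⟨Nat.pair m (2 * j), Nat.left_le_pair _ _, ?_⟩
    simp [spread, hx, hy]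

theorem IsOscillatingFamily.antichain {F : Type*} [Group F] [Finite F] [Nontrivial F] {α β : ℝ}
    (hαβ : α < β) {om : (ℕ → ({α, β} : Set ℝ)) → (ℕ → Fin 3)} {r : ℕ → ℕ} {ε : ℕ → ℝ}
    (h : IsOscillatingFamily F α β om r ε) :
    IsUncountableAntichain F α β (Set.range fun x => om (spread α β x)) := by
  have hne : ∀ x y : ℕ → Bool, x ≠ y →
      ¬ GrowthLE (bOmega F (om (spread α β x))) (bOmega F (om (spread α β y))) :=
    fun x y hxy => not_growthLE hαβ h (frequently_spread α β hxy)
  have hinj : Function.Injective fun x => om (spread α β x) := by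
    intro x y hxy
    by_contra hne'
    refine hne x y hne' ⟨1, fun n => ?_⟩
    dsimp only at hxy
    rw [hxy, one_mul]
  refine ⟨fun hc => ?_, ?_, ?_⟩
  · have : Countable (ℕ → Bool) :=
      (Equiv.ofInjective _ hinj).countable_iff.2 (Set.countable_coe_iff.2 hc)
    obtain ⟨e, he⟩ := exists_surjective_nat (ℕ → Bool)
    obtain ⟨n, hn⟩ := he fun n => !(e n n)
    simpa using congrFun hn n
  · rintro _ ⟨x, rfl⟩ _ ⟨y, rfl⟩ hxy
    have hxy' : x ≠ y := fun h => hxy (by rw [h])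
    exact ⟨hne x y hxy', hne y x hxy'.symm⟩
  · rintro _ ⟨x, rfl⟩
    exact (h.2.2.2.2 _).1

/-- Passage from a bound for `log log b` to a bound for `b` with a larger exponent. -/
theorem exists_exp_bound {β β' C : ℝ} (hβ : 0 < β) (hββ' : β < β') :
    ∃ D : ℝ, ∀ b : ℕ → ℕ, Monotone b → (∀ n, 2 ≤ n → 1 < b n) →
      (∀ n : ℕ, 2 ≤ n → Real.log (Real.log (b n)) ≤ β * Real.log n + C) →
      ∀ n : ℕ, (b n : ℝ) ≤ D * Real.exp ((n : ℝ) ^ β') := by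
  set K := Real.exp C with hK
  have hKpos : 0 < K := Real.exp_pos C
  set X := max 2 (K ^ (1 / (β' - β))) with hX
  have hX0 : 0 ≤ X := le_trans (by norm_num) (le_max_left _ _)
  refine ⟨Real.exp (K * X ^ β), fun b hmono hb1 hb n => ?_⟩
  have hbexp : ∀ n : ℕ, 2 ≤ n → (b n : ℝ) ≤ Real.exp (K * (n : ℝ) ^ β) := by
    intro n hn
    have hn0 : (0 : ℝ) < n := by exact_mod_cast (by omega : 0 < n)
    have hbn : (1 : ℝ) < b n := by exact_mod_cast hb1 n hn
    have h1 := hb n hn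
    rw [Real.log_le_iff_le_exp (Real.log_pos hbn), Real.log_le_iff_le_exp (by linarith),
      Real.exp_add, mul_comm β, ← Real.rpow_def_of_pos hn0] at h1
    rwa [mul_comm] at h1
  have hKX : 0 ≤ K * X ^ β := by positivity
  rw [← Real.exp_add]
  rcases le_total (n : ℝ) X with hnX | hnX
  · have h1 : ((max n 2 : ℕ) : ℝ) ≤ X := by
      push_cast
      exact max_le hnX (le_max_left _ _)
    calc (b n : ℝ) ≤ b (max n 2) := by exact_mod_cast hmono (le_max_left n 2)
      _ ≤ Real.exp (K * ((max n 2 : ℕ) : ℝ) ^ β) := hbexp _ (le_max_right _ _)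
      _ ≤ _ := Real.exp_le_exp.2 (by
        have h2 : ((max n 2 : ℕ) : ℝ) ^ β ≤ X ^ β :=
          Real.rpow_le_rpow (Nat.cast_nonneg _) h1 hβ.le
        have h3 : 0 ≤ (n : ℝ) ^ β' := by positivity
        nlinarith)
  · have hn2 : 2 ≤ n := by
      have : (2 : ℝ) ≤ n := (le_max_left _ _).trans hnX
      exact_mod_cast this
    have hn0 : (0 : ℝ) < n := by exact_mod_cast (by omega : 0 < n)
    refine (hbexp n hn2).trans (Real.exp_le_exp.2 ?_)
    have h1 : K ≤ (n : ℝ) ^ (β' - β) := by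
      have h2 : (K ^ (1 / (β' - β))) ^ (β' - β) ≤ (n : ℝ) ^ (β' - β) :=
        Real.rpow_le_rpow (by positivity) ((le_max_right _ _).trans hnX) (by linarith)
      rwa [← Real.rpow_mul hKpos.le, one_div_mul_cancel (by linarith), Real.rpow_one] at h2
    have h3 : K * (n : ℝ) ^ β ≤ (n : ℝ) ^ β' := by
      calc K * (n : ℝ) ^ β ≤ (n : ℝ) ^ (β' - β) * (n : ℝ) ^ β := by gcongr
        _ = _ := by rw [← Real.rpow_add hn0, sub_add_cancel]
    linarith

end GrowthGroups

end

theorem mainTheorem2 {F : Type*} [Group F] [Finite F] [Nontrivial F] (η α₀ : ℝ)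
    (hη : η ^ 3 + η ^ 2 + η - 2 = 0)
    (hα₀ : α₀ = Real.log 2 / (Real.log 2 - Real.log η)) :
    (∀ α β : ℝ, α₀ ≤ α → α < β → β ≤ 1 →
      ∃ Ω : Set (ℕ → Fin 3), GrowthGroups.IsUncountableAntichain F α β Ω) ∧
    (∀ β β' : ℝ, β < β' → β' ≤ 1 →
      ∃ C : ℝ, ∀ α : ℝ, α₀ ≤ α → α < β →
        ∃ Ω : Set (ℕ → Fin 3), GrowthGroups.IsUncountableAntichain F α β Ω ∧
          ∀ ω ∈ Ω, ∀ r : ℕ,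
            (GrowthGroups.bOmega F ω r : ℝ) ≤ C * Real.exp ((r : ℝ) ^ β')) ∧
    (∀ α β : ℝ, α₀ ≤ α → α < β → β ≤ 1 →
      ∃ (om : (ℕ → ({α, β} : Set ℝ)) → (ℕ → Fin 3)) (r : ℕ → ℕ) (ε : ℕ → ℝ),
        (∀ i, 2 ≤ r i) ∧ Tendsto r atTop atTop ∧
        (∀ i, 0 < ε i ∧ ε i < (β - α) / 2) ∧ Tendsto ε atTop (𝓝 0) ∧
        ∀ f : ℕ → ({α, β} : Set ℝ),
          (GrowthGroups.lowerExponent (GrowthGroups.bOmega F (om f)) = (α : EReal) ∧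
            GrowthGroups.upperExponent (GrowthGroups.bOmega F (om f)) = (β : EReal)) ∧
          (∀ i, (f i : ℝ) = β →
            β - ε i ≤ GrowthGroups.logLogRatio (GrowthGroups.bOmega F (om f)) (r i)) ∧
          (∀ i, (f i : ℝ) = α →
            GrowthGroups.logLogRatio (GrowthGroups.bOmega F (om f)) (r i) ≤ α + ε i)) := by
  have hα₀pos := GrowthGroups.alpha_zero_pos hη hα₀
  obtain ⟨C, hC⟩ := GrowthGroups.exists_isOscillatingFamily F hη hα₀
  refine ⟨fun α β hα hαβ hβ => ?_, fun β β' hββ' hβ' => ?_, fun α β hα hαβ hβ => ?_⟩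
  · obtain ⟨om, r, ε, h, -⟩ := hC α β hα hαβ hβ
    exact ⟨_, h.antichain hαβ⟩
  · by_cases hβ0 : 0 < β
    · obtain ⟨D, hD⟩ := GrowthGroups.exists_exp_bound (C := C) hβ0 hββ'
      refine ⟨D, fun α hα hαβ => ?_⟩
      obtain ⟨om, r, ε, h, hb⟩ := hC α β hα hαβ (by linarith)
      refine ⟨_, h.antichain hαβ, ?_⟩
      rintro _ ⟨x, rfl⟩
      exact hD _ (GrowthGroups.bOmega_mono F _) (fun n => GrowthGroups.one_lt_bOmega F _) (hb _)
    · exact ⟨0, fun α hα hαβ => absurd (hα₀pos.trans_le hα |>.trans hαβ) hβ0⟩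
  · obtain ⟨om, r, ε, h, -⟩ := hC α β hα hαβ hβ
    exact ⟨om, r, ε, h⟩
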